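/- All functions are real-valued and $2\pi$-periodic. $L_p$ ($1\le p<\infty$) carries the norm $\|\varphi\|_p=\big(\int_0^{2\pi}|\varphi(t)|^p\,dt\big)^{1/p}$, $C$ is the space of continuous $2\pi$-periodic functions with norm $\|f\|_C=\max_t|f(t)|$, and $a_k(f)=\frac1\pi\int_0^{2\pi}f(t)\cos kt\,dt$, $b_k(f)=\frac1\pi\int_0^{2\pi}f(t)\sin kt\,dt$. For $\psi:[1,\infty)\to(0,\infty)$, $\beta\in\mathbb R$ and $1\le p<\infty$, let $C^{\psi}_{\beta,p}$ be the set of all $f\in C$ for which $$\sum_{k=1}^{\infty}\frac{1}{\psi(k)}\Big(a_k(f)\cos\big(kx+\tfrac{\beta\pi}{2}\big)+b_k(f)\sin\big(kx+\tfrac{\beta\pi}{2}\big)\Big)$$ is the Fourier series of a function $\varphi\in L_p$ with $\|\varphi\|_p\le 1$. For $n\in\mathbb N=\{1,2,\dots\}$ and $s>0$ put $$Z^{s}_{n-1}(f;t)=\frac{a_0(f)}{2}+\sum_{k=1}^{n-1}\Big(1-\big(\tfrac kn\big)^s\Big)\big(a_k(f)\cos kt+b_k(f)\sin kt\big),$$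 $$E_n(C^{\psi}_{\beta,p})_C=\sup_{f\in C^{\psi}_{\beta,p}}\ \inf_{t_{n-1}}\|f-t_{n-1}\|_C,\qquad \mathcal E(C^{\psi}_{\beta,p};Z^s_{n-1})_C=\sup_{f\in C^{\psi}_{\beta,p}}\|f-Z^s_{n-1}(f;\cdot)\|_C,$$ where $t_{n-1}$ runs over the real trigonometric polynomials of order at most $n-1$. Write $A(n)\asymp B(n)$ if there are positive constants $c_1,c_2$ independent of $n$ (they may depend on the remaining parameters $p,\beta,\gamma,K,s$) with $c_1B(n)\le A(n)\le c_2B(n)$ for all indicated $n$. **Theorem.** Let $s>0$, $\beta\in\mathbb R$ and $\psi(t)=t^{-1/p}\ln^{-\gamma}(t+K)$. (i) If $1<p<\infty$, $\frac1p+\frac1{p'}=1$, $\gamma>1/p'$ and $K>e^{\gamma p'/2}$, then for $n\ge 2$ $$E_n(C^{\psi}_{\beta,p})_C\asymp\mathcal E(C^{\psi}_{\beta,p};Z^s_{n-1})_C\asymp\psi(n)\,n^{1/p}\ln^{1/p'}n .$$ (ii) If $p=1$, $\gamma>1$ and $K>e^{\gamma}$, then $$E_n(C^{\psi}_{\beta,1})_C\asymp\mathcal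 E(C^{\psi}_{\beta,1};Z^s_{n-1})_C\asymp\begin{cases}\psi(n)\,n\ln n\quad (n\ge 2), & \cos\frac{\beta\pi}{2}\ne 0,\\[2pt] \psi(n)\,n\quad (n\ge 1), & \cos\frac{\beta\pi}{2}=0.\end{cases}$$ -/

import Mathlib

open MeasureTheory Set
open scoped ENNReal

noncomputable section

namespace ZygmundApprox

/-- Cosine Fourier coefficient `a_k(f)` of a `2π`-periodic function. -/
def fourierA (f : ℝ → ℝ) (k : ℕ) : ℝ :=
  (1 / Real.pi) * ∫ x in (0 : ℝ)..(2 * Real.pi), f x * Real.cos (k * x)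

/-- Sine Fourier coefficient `b_k(f)` of a `2π`-periodic function. -/
def fourierB (f : ℝ → ℝ) (k : ℕ) : ℝ :=
  (1 / Real.pi) * ∫ x in (0 : ℝ)..(2 * Real.pi), f x * Real.sin (k * x)

/-- The space `L_p` of `2π`-periodic functions; the exponent is an extended nonnegative real. -/
def MemLper (p : ℝ≥0∞) (f : ℝ → ℝ) : Prop :=
  Function.Periodic f (2 * Real.pi) ∧ MemLp f p (volume.restrict (Ioc 0 (2 * Real.pi)))

/-- The norm of `L_p`, taken over one period with respect to (unnormalized) Lebesgue measure. -/
def normLper (p : ℝ≥0∞) (f : ℝ → ℝ) : ℝ≥0∞ :=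
  eLpNorm f p (volume.restrict (Ioc 0 (2 * Real.pi)))

/-- `φ` is a `(ψ, β)`-derivative of `f`: it is summable, and the series
`∑_{k ≥ 1} (1 / ψ k) (a_k(f) cos (k x + β π / 2) + b_k(f) sin (k x + β π / 2))`
is its Fourier series (the free term vanishes and the harmonics agree). -/
def IsPsiBetaDeriv (ψ : ℝ → ℝ) (β : ℝ) (f φ : ℝ → ℝ) : Prop :=
  MemLper 1 φ ∧ fourierA φ 0 = 0 ∧
    ∀ k : ℕ, 1 ≤ k → ∀ x : ℝ,
      (1 / ψ k) * (fourierA f k * Real.cos (k * x + β * Real.pi / 2)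
          + fourierB f k * Real.sin (k * x + β * Real.pi / 2))
        = fourierA φ k * Real.cos (k * x) + fourierB φ k * Real.sin (k * x)

/-- The class `C^ψ_{β,p}`: continuous `2π`-periodic functions having a `(ψ, β)`-derivative in the
unit ball of `L_p`. -/
def classC (ψ : ℝ → ℝ) (β : ℝ) (p : ℝ≥0∞) : Set (ℝ → ℝ) :=
  {f | Continuous f ∧ Function.Periodic f (2 * Real.pi) ∧
    ∃ φ : ℝ → ℝ, IsPsiBetaDeriv ψ β f φ ∧ MemLper p φ ∧ normLper p φ ≤ 1}

/-- The uniform norm, with values in `[0, ∞]`. -/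
def normC (f : ℝ → ℝ) : ℝ≥0∞ := ⨆ x : ℝ, ENNReal.ofReal |f x|

/-- Real trigonometric polynomials of order at most `n - 1` (for `n ≥ 1`). -/
def trigPoly (n : ℕ) : Set (ℝ → ℝ) :=
  {T | ∃ (c : ℝ) (a b : ℕ → ℝ), ∀ t : ℝ,
    T t = c + ∑ k ∈ Finset.Ico 1 n, (a k * Real.cos (k * t) + b k * Real.sin (k * t))}

/-- The Zygmund sum `Z^s_{n-1}(f; t)`. -/
def zygmundSum (s : ℝ) (n : ℕ) (f : ℝ → ℝ) (t : ℝ) : ℝ :=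
  fourierA f 0 / 2 + ∑ k ∈ Finset.Ico 1 n,
    (1 - ((k : ℝ) / (n : ℝ)) ^ s) *
      (fourierA f k * Real.cos (k * t) + fourierB f k * Real.sin (k * t))

/-- Best uniform approximation `E_n(F)_C` of a class `F` by trigonometric polynomials of order
at most `n - 1`. -/
def bestApprox (F : Set (ℝ → ℝ)) (n : ℕ) : ℝ≥0∞ :=
  ⨆ f ∈ F, ⨅ T ∈ trigPoly n, normC (fun x => f x - T x)

/-- Uniform deviation `𝓔(F; Z^s_{n-1})_C` of the Zygmund sums on a class `F`. -/
def zygmundDev (s : ℝ) (F : Set (ℝ → ℝ)) (n : ℕ) : ℝ≥0∞ :=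
  ⨆ f ∈ F, normC (fun x => f x - zygmundSum s n f x)

/-- `A(n) = O(B(n))` for `n ≥ N`: a single finite constant works for all these `n`. -/
def BigOFrom (N : ℕ) (A B : ℕ → ℝ≥0∞) : Prop :=
  ∃ c : ℝ, 0 < c ∧ ∀ n : ℕ, N ≤ n → A n ≤ ENNReal.ofReal c * B n

/-- `A(n) ≍ B(n)` for `n ≥ N`. -/
def OrderEqFrom (N : ℕ) (A B : ℕ → ℝ≥0∞) : Prop :=
  BigOFrom N A B ∧ BigOFrom N B A

/-- `ψ(t) = t^{-1/p} ln^{-γ}(t + K)`. -/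
def psiLog (p γ K : ℝ) (t : ℝ) : ℝ :=
  t ^ (-(1 / p)) * Real.log (t + K) ^ (-γ)

end ZygmundApprox

end

noncomputable section

namespace ZygmundApprox

/-! ### Trigonometric integrals and harmonics -/

/-! A Zygmund sum is itself a polynomial of order at most n - 1, so best approximation never exceeds
its deviation. It therefore suffices to bound the Zygmund deviation from above and the best
approximation from below by the same rate (`orderEqFrom_of_bigO`). De la Vallée-Poussin means V_N
serve both bounds: they reproduce polynomials of order below N and have norm at most 3 on C, being a
combination of two Fejér means.

Upper bounds. Since V_N f tends to f uniformly, it is enough to bound V_N f - Z f uniformly in N ≥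
n. This difference is a convolution of φ with a finite kernel D
(`vpMean_sub_zygmundSum_eq_integral`), so Hölder reduces everything to the norm of D in L_q, q = p'.
With a = 1/p < 1, cutting the sum near k = 1/u and summing by parts gives, up to constants, |D(u)| ≤
u^(a-1) ln^(-γ)(1/u + K) for u ≤ 1/n and |D(u)| ≤ u^(a-1) ln^(-γ)(n + K) for 1/n ≤ u ≤ π
(`abs_devKernel_le_of_small`, `abs_devKernel_le_of_large`). As (a-1)q = -1, the q-th power
integrates to order ln^(1-γq) n on either range; convergence at 0 is the condition γq > 1. For p = 1
the sup norm of D is needed. The trivial estimate gives ln^(1-γ) n. If cos(βπ/2) = 0, D is a sine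
series, and |sin ku| ≤ ku removes one logarithm (`abs_devKernel_one_le_of_cos_eq_zero`).

Lower bounds. One has |f - V_n f| ≤ 4 E_n(f) at every point (`ofReal_abs_sub_vpMean_le_bestApprox`),
and f - V_n f is explicit for a polynomial f. The (ψ, β)-derivatives are chosen as follows. For p >
1: the sum of k^(-1/q) cos(kt - c) over k < 4n², whose p-norm is O((ln n)^(1/p)), with c cancelling
the shift βπ/2. At 0 the harmonics in [2n, 4n²) add up to ln^(-γ)(n + K) ln n before normalization
(`bigO_bestApprox`). For p = 1 and cos(βπ/2) ≠ 0: a centred Fejér kernel of order 8n², evaluated at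
0. For p = 1 and cos(βπ/2) = 0: a centred Fejér kernel of order 4n, evaluated at π/(4n), where the n
harmonics in [2n, 3n) each contribute order ln^(-γ)(n + K)/n. -/

theorem integral_cos_int_mul_add (m : ℤ) (hm : m ≠ 0) (c : ℝ) :
    ∫ t in (0 : ℝ)..(2 * Real.pi), Real.cos (m * t + c) = 0 := by
  have h : (m : ℝ) ≠ 0 := by exact_mod_cast hm
  rw [intervalIntegral.integral_comp_mul_add (fun x => Real.cos x) h, integral_cos]
  have : (m : ℝ) * (2 * Real.pi) + c = c + m * (2 * Real.pi) := by ring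
  rw [this, Real.sin_add_int_mul_two_pi]
  simp

theorem integral_cos_mul_sub (k : ℕ) (hk : 1 ≤ k) (x : ℝ) :
    ∫ t in (0 : ℝ)..(2 * Real.pi), Real.cos (k * (x - t)) = 0 := by
  have h : ∀ t : ℝ, (k : ℝ) * (x - t) = ((-(k : ℤ) : ℤ) : ℝ) * t + k * x := by
    intro t
    push_cast
    ring
  simp_rw [h]
  exact integral_cos_int_mul_add _ (by omega) _

/-- The free phase d covers both families of orthogonality relations: d = 0 gives cosines, d = -π/2
gives sines. -/
theorem integral_cos_add_mul_cos_sub (j k : ℕ) (hk : 1 ≤ k) (d x : ℝ) :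
    ∫ t in (0 : ℝ)..(2 * Real.pi), Real.cos (j * t + d) * Real.cos (k * (x - t))
      = if j = k then Real.pi * Real.cos (k * x + d) else 0 := by
  have h1 : ∀ t : ℝ, Real.cos (j * t + d) * Real.cos (k * (x - t))
      = (1 / 2) * Real.cos (((j : ℤ) - k : ℤ) * t + (k * x + d))
        + (1 / 2) * Real.cos (((j : ℤ) + k : ℤ) * t + (d - k * x)) := by
    intro t
    have e1 : (((j : ℤ) - k : ℤ) : ℝ) * t + (k * x + d) = (j * t + d) + k * (x - t) := by
      push_cast; ring
    have e2 : (((j : ℤ) + k : ℤ) : ℝ) * t + (d - k * x) = (j * t + d) - k * (x - t) := by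
      push_cast; ring
    rw [e1, e2, Real.cos_add (j * t + d), Real.cos_sub (j * t + d)]
    ring
  simp_rw [h1]
  rw [intervalIntegral.integral_add (Continuous.intervalIntegrable (by fun_prop) _ _)
    (Continuous.intervalIntegrable (by fun_prop) _ _), intervalIntegral.integral_const_mul,
    intervalIntegral.integral_const_mul, integral_cos_int_mul_add ((j : ℤ) + k) (by omega)]
  split_ifs with h
  · subst h
    simp
    ring
  · rw [integral_cos_int_mul_add ((j : ℤ) - k) (by omega)]
    simp

/-- The `k`-th harmonic of `f`. -/
def harm (f : ℝ → ℝ) (k : ℕ) (x : ℝ) : ℝ :=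
  fourierA f k * Real.cos (k * x) + fourierB f k * Real.sin (k * x)

theorem harm_eq_integral {f : ℝ → ℝ} (hf : IntervalIntegrable f volume 0 (2 * Real.pi))
    (k : ℕ) (x : ℝ) :
    harm f k x = (1 / Real.pi) * ∫ t in (0 : ℝ)..(2 * Real.pi), f t * Real.cos (k * (x - t)) := by
  have h1 : ∀ t : ℝ, f t * Real.cos (k * (x - t))
      = Real.cos (k * x) * (f t * Real.cos (k * t))
        + Real.sin (k * x) * (f t * Real.sin (k * t)) := by
    intro t
    rw [mul_sub, Real.cos_sub]
    ring
  have hc : IntervalIntegrable (fun t => f t * Real.cos (k * t)) volume 0 (2 * Real.pi) :=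
    hf.mul_continuousOn (Continuous.continuousOn (by fun_prop))
  have hs : IntervalIntegrable (fun t => f t * Real.sin (k * t)) volume 0 (2 * Real.pi) :=
    hf.mul_continuousOn (Continuous.continuousOn (by fun_prop))
  simp_rw [h1]
  rw [intervalIntegral.integral_add (hc.const_mul _) (hs.const_mul _),
    intervalIntegral.integral_const_mul, intervalIntegral.integral_const_mul, harm, fourierA,
    fourierB]
  ring

theorem fourierA_zero (f : ℝ → ℝ) :
    fourierA f 0 = (1 / Real.pi) * ∫ t in (0 : ℝ)..(2 * Real.pi), f t := by
  simp [fourierA]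

theorem harm_trigPoly {T : ℝ → ℝ} {n : ℕ} {c : ℝ} {a b : ℕ → ℝ}
    (hT : ∀ t : ℝ, T t = c + ∑ k ∈ Finset.Ico 1 n, (a k * Real.cos (k * t) + b k * Real.sin (k * t)))
    (k : ℕ) (hk : 1 ≤ k) (x : ℝ) :
    harm T k x = if k < n then a k * Real.cos (k * x) + b k * Real.sin (k * x) else 0 := by
  obtain rfl : T = fun t => c + ∑ k ∈ Finset.Ico 1 n,
    (a k * Real.cos (k * t) + b k * Real.sin (k * t)) := funext hT
  rw [harm_eq_integral (Continuous.intervalIntegrable (by fun_prop) _ _)]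
  have h1 : ∀ t : ℝ, (c + ∑ j ∈ Finset.Ico 1 n, (a j * Real.cos (j * t) + b j * Real.sin (j * t)))
      * Real.cos (k * (x - t)) = c * Real.cos (k * (x - t)) + ∑ j ∈ Finset.Ico 1 n,
        (a j * (Real.cos (j * t + 0) * Real.cos (k * (x - t)))
          + b j * (Real.cos (j * t + -(Real.pi / 2)) * Real.cos (k * (x - t)))) := by
    intro t
    rw [add_mul, Finset.sum_mul]
    congr 1
    refine Finset.sum_congr rfl fun j _ => ?_
    rw [← sub_eq_add_neg (j * t : ℝ), Real.cos_sub_pi_div_two, add_zero]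
    ring
  simp_rw [h1]
  rw [intervalIntegral.integral_add (Continuous.intervalIntegrable (by fun_prop) _ _)
    (Continuous.intervalIntegrable (by fun_prop) _ _), intervalIntegral.integral_const_mul,
    integral_cos_mul_sub k hk, intervalIntegral.integral_finsetSum
    (fun i _ => Continuous.intervalIntegrable (by fun_prop) _ _)]
  have h2 : ∀ j ∈ Finset.Ico 1 n, ∫ t in (0 : ℝ)..(2 * Real.pi),
      (a j * (Real.cos (j * t + 0) * Real.cos (k * (x - t)))
          + b j * (Real.cos (j * t + -(Real.pi / 2)) * Real.cos (k * (x - t))))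
      = if j = k then Real.pi * (a k * Real.cos (k * x) + b k * Real.sin (k * x)) else 0 := by
    intro j _
    rw [intervalIntegral.integral_add (Continuous.intervalIntegrable (by fun_prop) _ _)
      (Continuous.intervalIntegrable (by fun_prop) _ _), intervalIntegral.integral_const_mul,
      intervalIntegral.integral_const_mul, integral_cos_add_mul_cos_sub j k hk,
      integral_cos_add_mul_cos_sub j k hk]
    split_ifs with h
    · subst h
      rw [← sub_eq_add_neg (j * x : ℝ), Real.cos_sub_pi_div_two, add_zero]
      ring
    · simp
  rw [Finset.sum_congr rfl h2, Finset.sum_ite_eq']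
  have : k ∈ Finset.Ico 1 n ↔ k < n := by simp [hk]
  simp only [this]
  split_ifs
  · field_simp [Real.pi_ne_zero]
    ring
  · simp

theorem fourierA_zero_trigPoly {T : ℝ → ℝ} {n : ℕ} {c : ℝ} {a b : ℕ → ℝ}
    (hT : ∀ t : ℝ, T t = c + ∑ k ∈ Finset.Ico 1 n, (a k * Real.cos (k * t) + b k * Real.sin (k * t))) :
    fourierA T 0 = 2 * c := by
  obtain rfl : T = fun t => c + ∑ k ∈ Finset.Ico 1 n,
    (a k * Real.cos (k * t) + b k * Real.sin (k * t)) := funext hT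
  rw [fourierA_zero]
  rw [intervalIntegral.integral_add (Continuous.intervalIntegrable (by fun_prop) _ _)
    (Continuous.intervalIntegrable (by fun_prop) _ _), intervalIntegral.integral_finsetSum
    (fun i _ => Continuous.intervalIntegrable (by fun_prop) _ _)]
  have h2 : ∀ j ∈ Finset.Ico 1 n, ∫ t in (0 : ℝ)..(2 * Real.pi),
      (a j * Real.cos (j * t) + b j * Real.sin (j * t)) = 0 := by
    intro j hj
    have hj1 : ((j : ℤ)) ≠ 0 := by have := (Finset.mem_Ico.1 hj).1; omega
    have h3 := integral_cos_int_mul_add j hj1 0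
    have h4 := integral_cos_int_mul_add j hj1 (-(Real.pi / 2))
    simp only [← sub_eq_add_neg, Real.cos_sub_pi_div_two, add_zero, Int.cast_natCast] at h3 h4
    rw [intervalIntegral.integral_add (Continuous.intervalIntegrable (by fun_prop) _ _)
      (Continuous.intervalIntegrable (by fun_prop) _ _), intervalIntegral.integral_const_mul,
      intervalIntegral.integral_const_mul, h3, h4]
    simp
  rw [Finset.sum_eq_zero h2]
  simp
  field_simp [Real.pi_ne_zero]

theorem trigPoly_mono {m n : ℕ} (h : m ≤ n) : trigPoly m ⊆ trigPoly n := by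
  rintro T ⟨c, a, b, hT⟩
  refine ⟨c, fun k => if k < m then a k else 0, fun k => if k < m then b k else 0, fun t => ?_⟩
  rw [hT]
  congr 1
  rw [← Finset.sum_subset (Finset.Ico_subset_Ico_right h : Finset.Ico 1 m ⊆ Finset.Ico 1 n)]
  · refine Finset.sum_congr rfl fun k hk => ?_
    simp [(Finset.mem_Ico.1 hk).2]
  · intro k hk hk'
    have : ¬ k < m := fun h => hk' (Finset.mem_Ico.2 ⟨(Finset.mem_Ico.1 hk).1, h⟩)
    simp [this]

theorem continuous_of_mem_trigPoly {n : ℕ} {T : ℝ → ℝ} (h : T ∈ trigPoly n) : Continuous T := by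
  obtain ⟨c, a, b, hT⟩ := h
  rw [funext hT]
  fun_prop

theorem zygmundSum_mem_trigPoly (s : ℝ) (n : ℕ) (f : ℝ → ℝ) : zygmundSum s n f ∈ trigPoly n := by
  refine ⟨fourierA f 0 / 2, fun k => (1 - ((k : ℝ) / (n : ℝ)) ^ s) * fourierA f k,
    fun k => (1 - ((k : ℝ) / (n : ℝ)) ^ s) * fourierB f k, fun t => ?_⟩
  rw [zygmundSum]
  congr 1
  exact Finset.sum_congr rfl fun k _ => by ring

theorem bestApprox_le_zygmundDev (s : ℝ) (F : Set (ℝ → ℝ)) (n : ℕ) :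
    bestApprox F n ≤ zygmundDev s F n :=
  iSup₂_mono fun f _ => iInf₂_le _ (zygmundSum_mem_trigPoly s n f)

/-! ### Fejér and de la Vallée-Poussin means -/

/-- The Fejér kernel of order `m`. -/
def fejer (m : ℕ) (t : ℝ) : ℝ :=
  1 + 2 * ∑ k ∈ Finset.Ico 1 m, (1 - (k : ℝ) / m) * Real.cos (k * t)

/-- The right side is |∑ e^(ijt)|². Adjoining the term e^(imt) adds 1 plus twice the sum of cos((m -
j)t) over j < m, which is the increment on the left. -/
theorem mul_fejer_eq (m : ℕ) (t : ℝ) :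
    m + 2 * ∑ k ∈ Finset.Ico 1 m, ((m : ℝ) - k) * Real.cos (k * t)
      = (∑ j ∈ Finset.range m, Real.cos (j * t)) ^ 2
        + (∑ j ∈ Finset.range m, Real.sin (j * t)) ^ 2 := by
  induction m with
  | zero => simp
  | succ m ih =>
    have h1 : ∑ k ∈ Finset.Ico 1 (m + 1), (((m + 1 : ℕ) : ℝ) - k) * Real.cos (k * t)
        = ∑ k ∈ Finset.Ico 1 m, ((m : ℝ) - k) * Real.cos (k * t)
          + ∑ k ∈ Finset.Ico 1 (m + 1), Real.cos (k * t) := by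
      rcases Nat.eq_zero_or_pos m with rfl | hm
      · simp
      · rw [Finset.sum_Ico_succ_top (by omega), Finset.sum_Ico_succ_top (by omega), ← add_assoc,
          ← Finset.sum_add_distrib]
        congr 1
        · refine Finset.sum_congr rfl fun k _ => ?_
          push_cast; ring
        · push_cast; ring
    have h2 : ∑ k ∈ Finset.Ico 1 (m + 1), Real.cos (k * t)
        = Real.cos (m * t) * ∑ j ∈ Finset.range m, Real.cos (j * t)
          + Real.sin (m * t) * ∑ j ∈ Finset.range m, Real.sin (j * t) := by
      rw [Finset.mul_sum, Finset.mul_sum, ← Finset.sum_add_distrib,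
        Finset.sum_Ico_eq_sum_range]
      simp only [Nat.add_sub_cancel]
      rw [← Finset.sum_range_reflect]
      refine Finset.sum_congr rfl fun j hj => ?_
      rw [← Real.cos_sub]
      have hj := Finset.mem_range.1 hj
      congr 1
      rw [← sub_mul]
      congr 1
      have : 1 + (m - 1 - j) = m - j := by omega
      rw [this, Nat.cast_sub hj.le]
    rw [h1, Finset.sum_range_succ, Finset.sum_range_succ]
    have h3 := Real.sin_sq_add_cos_sq (m * t)
    rw [h2]
    push_cast
    linear_combination ih - h3

theorem fejer_nonneg (m : ℕ) (t : ℝ) : 0 ≤ fejer m t := by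
  rcases Nat.eq_zero_or_pos m with rfl | hm
  · simp [fejer]
  · have hm' : (0 : ℝ) < m := by exact_mod_cast hm
    have h : (m : ℝ) * fejer m t = m + 2 * ∑ k ∈ Finset.Ico 1 m, ((m : ℝ) - k) * Real.cos (k * t) := by
      rw [fejer, mul_add, mul_one, mul_left_comm, Finset.mul_sum]
      congr 2
      refine Finset.sum_congr rfl fun k _ => ?_
      field_simp
    rw [mul_fejer_eq] at h
    have : 0 ≤ (m : ℝ) * fejer m t := by rw [h]; positivity
    exact nonneg_of_mul_nonneg_right this hm'

theorem continuous_fejer (m : ℕ) : Continuous (fejer m) := by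
  unfold fejer
  fun_prop

theorem integral_fejer_sub (m : ℕ) (x : ℝ) :
    ∫ t in (0 : ℝ)..(2 * Real.pi), fejer m (x - t) = 2 * Real.pi := by
  unfold fejer
  rw [intervalIntegral.integral_add (Continuous.intervalIntegrable (by fun_prop) _ _)
    (Continuous.intervalIntegrable (by fun_prop) _ _), intervalIntegral.integral_const_mul,
    intervalIntegral.integral_finsetSum
    (fun i _ => Continuous.intervalIntegrable (by fun_prop) _ _)]
  rw [Finset.sum_eq_zero]
  · simp
  · intro k hk
    rw [intervalIntegral.integral_const_mul, integral_cos_mul_sub k (Finset.mem_Ico.1 hk).1,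
      mul_zero]

/-- The Fejér mean of order `m` of `f`. -/
def fejerMean (m : ℕ) (f : ℝ → ℝ) (x : ℝ) : ℝ :=
  fourierA f 0 / 2 + ∑ k ∈ Finset.Ico 1 m, (1 - (k : ℝ) / m) * harm f k x

theorem fejerMean_eq_integral {f : ℝ → ℝ} (hf : IntervalIntegrable f volume 0 (2 * Real.pi))
    (m : ℕ) (x : ℝ) :
    fejerMean m f x
      = (1 / (2 * Real.pi)) * ∫ t in (0 : ℝ)..(2 * Real.pi), f t * fejer m (x - t) := by
  have h1 : ∀ t : ℝ, f t * fejer m (x - t) = f t + ∑ k ∈ Finset.Ico 1 m,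
      (2 * (1 - (k : ℝ) / m)) * (f t * Real.cos (k * (x - t))) := by
    intro t
    rw [fejer, mul_add, mul_one, Finset.mul_sum, Finset.mul_sum]
    congr 1
    exact Finset.sum_congr rfl fun k _ => by ring
  have hc : ∀ k : ℕ, IntervalIntegrable (fun t => f t * Real.cos (k * (x - t))) volume 0
      (2 * Real.pi) := fun k => hf.mul_continuousOn (Continuous.continuousOn (by fun_prop))
  have hs : IntervalIntegrable (fun t => ∑ k ∈ Finset.Ico 1 m,
      (2 * (1 - (k : ℝ) / m)) * (f t * Real.cos (k * (x - t)))) volume 0 (2 * Real.pi) := by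
    simpa only [Finset.sum_fn] using IntervalIntegrable.sum (Finset.Ico 1 m)
      fun k _ => (hc k).const_mul (2 * (1 - (k : ℝ) / m))
  simp_rw [h1]
  rw [intervalIntegral.integral_add hf hs,
    intervalIntegral.integral_finsetSum (fun k _ => (hc k).const_mul _), fejerMean, fourierA_zero,
    mul_add, Finset.mul_sum]
  congr 1
  · ring
  · refine Finset.sum_congr rfl fun k _ => ?_
    rw [harm_eq_integral hf, intervalIntegral.integral_const_mul]
    ring

/-- The Fejér kernel is nonnegative with mean value 1, so the means are averages of f. -/
theorem abs_fejerMean_le {f : ℝ → ℝ} (hf : Continuous f) {M : ℝ} (hM : ∀ x, |f x| ≤ M) (m : ℕ)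
    (x : ℝ) : |fejerMean m f x| ≤ M := by
  have hpi := Real.pi_pos
  rw [fejerMean_eq_integral (hf.intervalIntegrable _ _), abs_mul, abs_of_pos (by positivity)]
  have hF : Continuous fun t => fejer m (x - t) := (continuous_fejer m).comp (by fun_prop)
  have h : |∫ t in (0 : ℝ)..(2 * Real.pi), f t * fejer m (x - t)|
      ≤ ∫ t in (0 : ℝ)..(2 * Real.pi), M * fejer m (x - t) := by
    refine (intervalIntegral.abs_integral_le_integral_abs (by positivity)).trans ?_
    refine intervalIntegral.integral_mono_on (by positivity)
      (Continuous.intervalIntegrable (by fun_prop) _ _)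
      (Continuous.intervalIntegrable (by fun_prop) _ _) fun t _ => ?_
    rw [abs_mul, abs_of_nonneg (fejer_nonneg _ _)]
    exact mul_le_mul_of_nonneg_right (hM t) (fejer_nonneg _ _)
  rw [intervalIntegral.integral_const_mul, integral_fejer_sub] at h
  calc _ ≤ 1 / (2 * Real.pi) * (M * (2 * Real.pi)) := by gcongr
    _ = M := by field_simp

/-- The multipliers of the de la Vallée-Poussin means. -/
def vpCoef (N k : ℕ) : ℝ := max 0 (min 1 (2 - (k : ℝ) / N))

/-- The de la Vallée-Poussin mean of `f`, of order `2 N - 1`. -/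
def vpMean (N : ℕ) (f : ℝ → ℝ) (x : ℝ) : ℝ :=
  fourierA f 0 / 2 + ∑ k ∈ Finset.Ico 1 (2 * N), vpCoef N k * harm f k x

theorem vpCoef_nonneg (N k : ℕ) : 0 ≤ vpCoef N k := le_max_left _ _

theorem vpCoef_le_one (N k : ℕ) : vpCoef N k ≤ 1 := max_le zero_le_one (min_le_left _ _)

theorem vpCoef_of_le {N k : ℕ} (hN : 1 ≤ N) (h : k ≤ N) : vpCoef N k = 1 := by
  have : (k : ℝ) / N ≤ 1 := div_le_one_of_le₀ (by exact_mod_cast h) (by positivity)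
  rw [vpCoef, min_eq_left (by linarith), max_eq_right zero_le_one]

theorem vpCoef_of_ge {N k : ℕ} (hN : 1 ≤ N) (h : N ≤ k) (h2 : k ≤ 2 * N) :
    vpCoef N k = 2 - (k : ℝ) / N := by
  have hN' : (0 : ℝ) < N := by exact_mod_cast hN
  have h3 : 1 ≤ (k : ℝ) / N := (one_le_div hN').2 (by exact_mod_cast h)
  have h4 : (k : ℝ) / N ≤ 2 := (div_le_iff₀ hN').2 (by exact_mod_cast h2)
  rw [vpCoef, min_eq_right (by linarith), max_eq_right (by linarith)]

theorem vpCoef_eq_zero {N k : ℕ} (hN : 1 ≤ N) (h : 2 * N ≤ k) : vpCoef N k = 0 := by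
  have hN' : (0 : ℝ) < N := by exact_mod_cast hN
  have h4 : 2 ≤ (k : ℝ) / N := (le_div_iff₀ hN').2 (by exact_mod_cast h)
  rw [vpCoef, max_eq_left ((min_le_right _ _).trans (by linarith))]

theorem vpCoef_antitone (N : ℕ) : Antitone (vpCoef N) := by
  intro i j hij
  unfold vpCoef
  gcongr

/-- On multipliers, 2(1 - k/(2N)) - (1 - k/N) equals 1 for k < N, and without the second term it
equals 2 - k/N. This is the source of the norm bound 3 = 2 + 1. -/
theorem vpMean_eq {N : ℕ} (hN : 1 ≤ N) (f : ℝ → ℝ) (x : ℝ) :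
    vpMean N f x = 2 * fejerMean (2 * N) f x - fejerMean N f x := by
  have hN' : (0 : ℝ) < N := by exact_mod_cast hN
  have h1 : ∑ k ∈ Finset.Ico 1 N, (1 - (k : ℝ) / N) * harm f k x
      = ∑ k ∈ Finset.Ico 1 (2 * N), (if k < N then (1 - (k : ℝ) / N) else 0) * harm f k x := by
    rw [← Finset.sum_subset
      (Finset.Ico_subset_Ico_right (by omega) : Finset.Ico 1 N ⊆ Finset.Ico 1 (2 * N))]
    · refine Finset.sum_congr rfl fun k hk => ?_
      simp [(Finset.mem_Ico.1 hk).2]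
    · intro k hk hk'
      have : ¬ k < N := fun h => hk' (Finset.mem_Ico.2 ⟨(Finset.mem_Ico.1 hk).1, h⟩)
      simp [this]
  have h2 : ∑ k ∈ Finset.Ico 1 (2 * N), vpCoef N k * harm f k x
      = 2 * ∑ k ∈ Finset.Ico 1 (2 * N), (1 - (k : ℝ) / (2 * N : ℕ)) * harm f k x
        - ∑ k ∈ Finset.Ico 1 N, (1 - (k : ℝ) / N) * harm f k x := by
    rw [h1, Finset.mul_sum, ← Finset.sum_sub_distrib]
    refine Finset.sum_congr rfl fun k hk => ?_
    have hk2 := (Finset.mem_Ico.1 hk).2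
    split_ifs with h
    · rw [vpCoef_of_le hN h.le]
      push_cast
      field_simp
      ring
    · rw [vpCoef_of_ge hN (by omega) hk2.le]
      push_cast
      field_simp
      ring
  rw [vpMean, fejerMean, fejerMean, h2]
  ring

theorem abs_vpMean_le {f : ℝ → ℝ} (hf : Continuous f) {M : ℝ} (hM : ∀ x, |f x| ≤ M) {N : ℕ}
    (hN : 1 ≤ N) (x : ℝ) : |vpMean N f x| ≤ 3 * M := by
  rw [vpMean_eq hN]
  have h1 := abs_le.1 (abs_fejerMean_le hf hM (2 * N) x)
  have h2 := abs_le.1 (abs_fejerMean_le hf hM N x)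
  rw [abs_le]
  constructor <;> linarith [h1.1, h1.2, h2.1, h2.2]

theorem harm_sub {f g : ℝ → ℝ} (hf : IntervalIntegrable f volume 0 (2 * Real.pi))
    (hg : IntervalIntegrable g volume 0 (2 * Real.pi)) (k : ℕ) (x : ℝ) :
    harm (fun t => f t - g t) k x = harm f k x - harm g k x := by
  rw [harm_eq_integral (hf.sub hg), harm_eq_integral hf, harm_eq_integral hg, ← mul_sub,
    ← intervalIntegral.integral_sub]
  · simp_rw [sub_mul]
  · exact hf.mul_continuousOn (Continuous.continuousOn (by fun_prop))
  · exact hg.mul_continuousOn (Continuous.continuousOn (by fun_prop))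

theorem vpMean_sub {f g : ℝ → ℝ} (hf : IntervalIntegrable f volume 0 (2 * Real.pi))
    (hg : IntervalIntegrable g volume 0 (2 * Real.pi)) (N : ℕ) (x : ℝ) :
    vpMean N (fun t => f t - g t) x = vpMean N f x - vpMean N g x := by
  have h0 : fourierA (fun t => f t - g t) 0 = fourierA f 0 - fourierA g 0 := by
    rw [fourierA_zero, fourierA_zero, fourierA_zero, ← mul_sub,
      ← intervalIntegral.integral_sub hf hg]
  simp only [vpMean, harm_sub hf hg, mul_sub, Finset.sum_sub_distrib, h0]
  ring

theorem vpMean_trigPoly {n : ℕ} (hn : 1 ≤ n) {T : ℝ → ℝ} (h : T ∈ trigPoly n) (x : ℝ) :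
    vpMean n T x = T x := by
  obtain ⟨c, a, b, hT⟩ := h
  rw [vpMean, fourierA_zero_trigPoly hT, hT x]
  congr 1
  · ring
  · rw [← Finset.sum_subset
      (Finset.Ico_subset_Ico_right (by omega) : Finset.Ico 1 n ⊆ Finset.Ico 1 (2 * n))]
    · refine Finset.sum_congr rfl fun k hk => ?_
      have hk := Finset.mem_Ico.1 hk
      rw [harm_trigPoly hT k hk.1, if_pos hk.2, vpCoef_of_le hn hk.2.le, one_mul]
    · intro k hk hk'
      have hk := Finset.mem_Ico.1 hk
      have : ¬ k < n := fun h => hk' (Finset.mem_Ico.2 ⟨hk.1, h⟩)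
      rw [harm_trigPoly hT k hk.1, if_neg this, mul_zero]

/-- Since V_n T = T, the error is (f - T) - V_n(f - T), and 1 + 3 = 4. -/
theorem abs_sub_vpMean_le {f T : ℝ → ℝ} (hf : Continuous f) {n : ℕ} (hn : 1 ≤ n)
    (hT : T ∈ trigPoly n) {M : ℝ} (hM : ∀ x, |f x - T x| ≤ M) (x : ℝ) :
    |f x - vpMean n f x| ≤ 4 * M := by
  have hTc := continuous_of_mem_trigPoly hT
  have h1 := abs_vpMean_le (hf.sub hTc) hM hn x
  change |vpMean n (fun t => f t - T t) x| ≤ _ at h1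
  rw [vpMean_sub (hf.intervalIntegrable _ _) (hTc.intervalIntegrable _ _),
    vpMean_trigPoly hn hT] at h1
  have h2 := abs_le.1 (hM x)
  have h1 := abs_le.1 h1
  rw [abs_le]
  constructor <;> linarith [h1.1, h1.2, h2.1, h2.2]

/-- The tool for all lower bounds: the infimum over polynomials is replaced by one explicit operator
evaluated at one point. -/
theorem ofReal_abs_sub_vpMean_le_bestApprox {F : Set (ℝ → ℝ)} {f : ℝ → ℝ} (hF : f ∈ F)
    (hf : Continuous f) {n : ℕ} (hn : 1 ≤ n) (x : ℝ) :
    ENNReal.ofReal (|f x - vpMean n f x| / 4) ≤ bestApprox F n := by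
  refine le_trans ?_ (le_iSup₂ (f := fun f (_ : f ∈ F) => ⨅ T ∈ trigPoly n,
    normC (fun x => f x - T x)) f hF)
  refine le_iInf₂ fun T hT => ?_
  by_cases htop : normC (fun x => f x - T x) = ⊤
  · simp [htop]
  rw [← ENNReal.ofReal_toReal htop]
  refine ENNReal.ofReal_le_ofReal ?_
  have := abs_sub_vpMean_le hf hn hT (M := (normC (fun x => f x - T x)).toReal) (fun y => ?_) x
  · linarith
  · exact (ENNReal.ofReal_le_iff_le_toReal htop).1
      (le_iSup (fun x => ENNReal.ofReal |f x - T x|) y)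

/-! ### Density of trigonometric polynomials -/

theorem add_mem_trigPoly {n : ℕ} {S T : ℝ → ℝ} (hS : S ∈ trigPoly n) (hT : T ∈ trigPoly n) :
    (fun t => S t + T t) ∈ trigPoly n := by
  obtain ⟨c, a, b, hS⟩ := hS
  obtain ⟨c', a', b', hT⟩ := hT
  refine ⟨c + c', fun k => a k + a' k, fun k => b k + b' k, fun t => ?_⟩
  beta_reduce
  rw [hS, hT, add_add_add_comm, ← Finset.sum_add_distrib]
  congr 1
  exact Finset.sum_congr rfl fun k _ => by ring

theorem const_mul_mem_trigPoly {n : ℕ} {T : ℝ → ℝ} (r : ℝ) (hT : T ∈ trigPoly n) :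
    (fun t => r * T t) ∈ trigPoly n := by
  obtain ⟨c, a, b, hT⟩ := hT
  refine ⟨r * c, fun k => r * a k, fun k => r * b k, fun t => ?_⟩
  beta_reduce
  rw [hT, mul_add, Finset.mul_sum]
  congr 1
  exact Finset.sum_congr rfl fun k _ => by ring

theorem cos_mem_trigPoly (k : ℕ) : (fun t : ℝ => Real.cos (k * t)) ∈ trigPoly (k + 1) := by
  rcases Nat.eq_zero_or_pos k with rfl | hk
  · exact ⟨1, 0, 0, fun t => by simp⟩
  · refine ⟨0, fun j => if j = k then 1 else 0, 0, fun t => ?_⟩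
    simp
    omega

theorem sin_mem_trigPoly (k : ℕ) : (fun t : ℝ => Real.sin (k * t)) ∈ trigPoly (k + 1) := by
  rcases Nat.eq_zero_or_pos k with rfl | hk
  · exact ⟨0, 0, 0, fun t => by simp⟩
  · refine ⟨0, 0, fun j => if j = k then 1 else 0, fun t => ?_⟩
    simp
    omega

instance : Fact (0 < 2 * Real.pi) := ⟨Real.two_pi_pos⟩

/-- Real and imaginary parts are carried together because multiplication by a complex scalar mixes
them. -/
theorem exists_re_im_mem_trigPoly {g : C(AddCircle (2 * Real.pi), ℂ)}
    (hg : g ∈ Submodule.span ℂ (range (@fourier (2 * Real.pi)))) :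
    ∃ n : ℕ, 1 ≤ n ∧ (fun x : ℝ => (g x).re) ∈ trigPoly n ∧
      (fun x : ℝ => (g x).im) ∈ trigPoly n := by
  induction hg using Submodule.span_induction with
  | mem g hg =>
    obtain ⟨m, rfl⟩ := hg
    refine ⟨m.natAbs + 1, by omega, ?_⟩
    have h : ∀ x : ℝ, fourier m (x : AddCircle (2 * Real.pi))
        = Complex.exp ((m * x : ℝ) * Complex.I) := by
      intro x
      rw [fourier_coe_apply]
      congr 1
      push_cast
      have : (Real.pi : ℂ) ≠ 0 := by exact_mod_cast Real.pi_ne_zero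
      field_simp
    simp only [h, Complex.exp_ofReal_mul_I_re, Complex.exp_ofReal_mul_I_im]
    have hc := cos_mem_trigPoly m.natAbs
    have hs := sin_mem_trigPoly m.natAbs
    rcases Int.natAbs_eq m with hm | hm
    · have e : (m : ℝ) = (m.natAbs : ℝ) :=
        (congrArg (Int.cast : ℤ → ℝ) hm).trans (Int.cast_natCast _)
      rw [e]
      exact ⟨hc, hs⟩
    · have e : (m : ℝ) = -(m.natAbs : ℝ) :=
        (congrArg (Int.cast : ℤ → ℝ) hm).trans (by rw [Int.cast_neg, Int.cast_natCast])
      rw [e]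
      refine ⟨by simpa using hc, by simpa using const_mul_mem_trigPoly (-1) hs⟩
  | zero => exact ⟨1, le_rfl, ⟨0, 0, 0, fun t => by simp⟩, ⟨0, 0, 0, fun t => by simp⟩⟩
  | add f g _ _ hf hg =>
    obtain ⟨m, hm, h1, h2⟩ := hf
    obtain ⟨n, hn, h3, h4⟩ := hg
    refine ⟨max m n, by omega, ?_, ?_⟩
    · simpa using add_mem_trigPoly (trigPoly_mono (le_max_left m n) h1)
        (trigPoly_mono (le_max_right m n) h3)
    · simpa using add_mem_trigPoly (trigPoly_mono (le_max_left m n) h2)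
        (trigPoly_mono (le_max_right m n) h4)
  | smul a g _ hg =>
    obtain ⟨m, hm, h1, h2⟩ := hg
    refine ⟨m, hm, ?_, ?_⟩
    · have := add_mem_trigPoly (const_mul_mem_trigPoly a.re h1)
        (const_mul_mem_trigPoly (-a.im) h2)
      simpa [sub_eq_add_neg] using this
    · simpa using add_mem_trigPoly (const_mul_mem_trigPoly a.re h2)
        (const_mul_mem_trigPoly a.im h1)

theorem exists_trigPoly_near {f : ℝ → ℝ} (hf : Continuous f)
    (hp : Function.Periodic f (2 * Real.pi)) {ε : ℝ} (hε : 0 < ε) :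
    ∃ n : ℕ, 1 ≤ n ∧ ∃ T ∈ trigPoly n, ∀ x, |f x - T x| ≤ ε := by
  have hp' : Function.Periodic (fun x => (f x : ℂ)) (2 * Real.pi) := fun x => by simp [hp x]
  have hc : Continuous (hp'.lift) :=
    continuous_quot_lift _ (Complex.continuous_ofReal.comp hf)
  let F : C(AddCircle (2 * Real.pi), ℂ) := ⟨hp'.lift, hc⟩
  have hF : F ∈ (Submodule.span ℂ (range (@fourier (2 * Real.pi)))).topologicalClosure := by
    rw [span_fourier_closure_eq_top]
    trivial
  obtain ⟨g, hg, hd⟩ := Metric.mem_closure_iff.1 hF ε hε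
  obtain ⟨n, hn, h1, -⟩ := exists_re_im_mem_trigPoly hg
  refine ⟨n, hn, _, h1, fun x => ?_⟩
  have h2 : dist (F x) (g x) ≤ ε := (ContinuousMap.dist_apply_le_dist _).trans hd.le
  have h3 : F x = (f x : ℂ) := Function.Periodic.lift_coe hp' x
  rw [h3, dist_eq_norm] at h2
  have h4 := Complex.abs_re_le_norm ((f x : ℂ) - g x)
  simp only [Complex.sub_re, Complex.ofReal_re] at h4
  exact h4.trans h2

/-- The means of a continuous periodic f converge to it uniformly, so a bound valid for all large N
passes to f. No convergence of the Fourier series of f is needed, and all later kernels are finite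
sums. -/
theorem abs_sub_le_of_vpMean {f : ℝ → ℝ} (hf : Continuous f)
    (hp : Function.Periodic f (2 * Real.pi)) {x y B : ℝ} {n : ℕ}
    (h : ∀ N, n ≤ N → 1 ≤ N → |vpMean N f x - y| ≤ B) : |f x - y| ≤ B := by
  refine le_of_forall_pos_le_add fun ε hε => ?_
  -- The quarter compensates the factor 4 in `abs_sub_vpMean_le`.
  obtain ⟨m, hm, T, hT, hfT⟩ := exists_trigPoly_near hf hp (ε := ε / 4) (by positivity)
  have h1 := abs_sub_vpMean_le hf (n := max m n) (by omega)
    (trigPoly_mono (le_max_left m n) hT) hfT x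
  have h2 := h (max m n) (by omega) (by omega)
  have := abs_sub_le (f x) (vpMean (max m n) f x) y
  linarith

/-! ### Summation by parts -/

/-- Abel summation with the boundary term kept on the left, so that c needs neither sign nor
monotonicity. -/
theorem abs_sum_Ico_mul_sub_le {c e : ℕ → ℝ} {M N : ℕ} (hMN : M ≤ N) {B : ℝ}
    (he : ∀ j, M ≤ j → j ≤ N → |∑ k ∈ Finset.Ico M j, e k| ≤ B) :
    |∑ k ∈ Finset.Ico M N, c k * e k - c N * ∑ k ∈ Finset.Ico M N, e k|
      ≤ ∑ k ∈ Finset.Ico M N, |c k - c (k + 1)| * B := by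
  induction N, hMN using Nat.le_induction with
  | base => simp
  | succ N hMN ih =>
    rw [Finset.sum_Ico_succ_top hMN, Finset.sum_Ico_succ_top hMN (fun k => |c k - c (k + 1)| * B)]
    have h1 := ih fun j h1 h2 => he j h1 (h2.trans N.le_succ)
    have h2 := he (N + 1) (by omega) le_rfl
    have h3 : ∑ k ∈ Finset.Ico M N, c k * e k + c N * e N
        - c (N + 1) * ∑ k ∈ Finset.Ico M (N + 1), e k
        = (∑ k ∈ Finset.Ico M N, c k * e k - c N * ∑ k ∈ Finset.Ico M N, e k)
          + (c N - c (N + 1)) * ∑ k ∈ Finset.Ico M (N + 1), e k := by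
      rw [Finset.sum_Ico_succ_top hMN]
      ring
    rw [h3]
    refine (abs_add_le _ _).trans (add_le_add h1 ?_)
    rw [abs_mul]
    exact mul_le_mul_of_nonneg_left h2 (abs_nonneg _)

theorem abs_sum_Ico_mul_le_of_antitone {c e : ℕ → ℝ} {M N : ℕ} (hMN : M ≤ N) {B : ℝ}
    (hc : ∀ k, M ≤ k → k < N → c (k + 1) ≤ c k) (h0 : 0 ≤ c N)
    (he : ∀ j, M ≤ j → j ≤ N → |∑ k ∈ Finset.Ico M j, e k| ≤ B) :
    |∑ k ∈ Finset.Ico M N, c k * e k| ≤ c M * B := by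
  have h1 := abs_sum_Ico_mul_sub_le (c := c) hMN he
  have h2 : ∑ k ∈ Finset.Ico M N, |c k - c (k + 1)| * B = (c M - c N) * B := by
    rw [← Finset.sum_mul]
    congr 1
    rw [← neg_sub (c N), ← Finset.sum_Ico_sub c hMN, ← Finset.sum_neg_distrib]
    refine Finset.sum_congr rfl fun k hk => ?_
    have hk := Finset.mem_Ico.1 hk
    rw [abs_of_nonneg (by linarith [hc k hk.1 hk.2])]
    ring
  have h3 : |c N * ∑ k ∈ Finset.Ico M N, e k| ≤ c N * B := by
    rw [abs_mul, abs_of_nonneg h0]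
    exact mul_le_mul_of_nonneg_left (he N hMN le_rfl) h0
  rw [h2] at h1
  rw [abs_le] at *
  constructor <;> linarith [h1.1, h1.2, h3.1, h3.2]

theorem abs_sum_Ico_mul_le_of_monotone {c e : ℕ → ℝ} {M N : ℕ} (hMN : M ≤ N) {B : ℝ}
    (hc : ∀ k, M ≤ k → k < N → c k ≤ c (k + 1)) (h0 : 0 ≤ c M)
    (he : ∀ j, M ≤ j → j ≤ N → |∑ k ∈ Finset.Ico M j, e k| ≤ B) :
    |∑ k ∈ Finset.Ico M N, c k * e k| ≤ 2 * c N * B := by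
  have hB : 0 ≤ B := (abs_nonneg _).trans (he M le_rfl hMN)
  have h1 := abs_sum_Ico_mul_sub_le (c := c) hMN he
  have h2 : ∑ k ∈ Finset.Ico M N, |c k - c (k + 1)| = c N - c M := by
    rw [← Finset.sum_Ico_sub c hMN]
    refine Finset.sum_congr rfl fun k hk => ?_
    have hk := Finset.mem_Ico.1 hk
    rw [abs_of_nonpos (by linarith [hc k hk.1 hk.2])]
    ring
  have h4 : 0 ≤ ∑ k ∈ Finset.Ico M N, |c k - c (k + 1)| :=
    Finset.sum_nonneg fun k _ => abs_nonneg _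
  have h3 : |c N * ∑ k ∈ Finset.Ico M N, e k| ≤ c N * B := by
    rw [abs_mul, abs_of_nonneg (by linarith)]
    exact mul_le_mul_of_nonneg_left (he N hMN le_rfl) (by linarith)
  rw [← Finset.sum_mul, h2] at h1
  have h5 := mul_nonneg h0 hB
  rw [abs_le] at *
  constructor <;> linarith [h1.1, h1.2, h3.1, h3.2]

/-- Abel summation twice: first against the increasing factor, then against the decreasing one. The
product itself need not be monotone. -/
theorem abs_sum_Ico_mul_mul_le {a b e : ℕ → ℝ} {M N : ℕ} (hMN : M ≤ N) {B : ℝ}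
    (ha : ∀ k, M ≤ k → k < N → a k ≤ a (k + 1)) (ha0 : 0 ≤ a M)
    (hb : ∀ k, M ≤ k → k < N → b (k + 1) ≤ b k) (hb0 : 0 ≤ b N)
    (he : ∀ j, M ≤ j → j ≤ N → |∑ k ∈ Finset.Ico M j, e k| ≤ B) :
    |∑ k ∈ Finset.Ico M N, b k * (a k * e k)| ≤ b M * (2 * a N * B) := by
  have hB : 0 ≤ B := (abs_nonneg _).trans (he M le_rfl hMN)
  refine abs_sum_Ico_mul_le_of_antitone hMN hb hb0 fun j hj1 hj2 => ?_
  refine (abs_sum_Ico_mul_le_of_monotone hj1 (fun k h1 h2 => ha k h1 (h2.trans_le hj2)) ha0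
    fun i h1 h2 => he i h1 (h2.trans hj2)).trans ?_
  have : a j ≤ a N := by
    have key : ∀ i, j ≤ i → i ≤ N → a j ≤ a i := by
      intro i hi
      induction i, hi using Nat.le_induction with
      | base => exact fun _ => le_rfl
      | succ i hi ih => exact fun h => (ih (by omega)).trans (ha i (by omega) (by omega))
    exact key N hj2 le_rfl
  gcongr

/-- Multiplication by 2 sin(u/2) makes the sum telescope to a difference of two sines; Jordan's
inequality gives sin(u/2) ≥ u/π. -/
theorem abs_sum_cos_le (M j : ℕ) (d : ℝ) {u : ℝ} (hu : 0 < u) (hu' : u ≤ Real.pi) :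
    |∑ k ∈ Finset.Ico M j, Real.cos (k * u - d)| ≤ Real.pi / u := by
  rcases le_total j M with h | h
  · rw [Finset.Ico_eq_empty_of_le h]
    simp
    positivity
  have h1 : 2 * Real.sin (u / 2) * ∑ k ∈ Finset.Ico M j, Real.cos (k * u - d)
      = Real.sin (j * u - d - u / 2) - Real.sin (M * u - d - u / 2) := by
    rw [Finset.mul_sum, ← Finset.sum_Ico_sub (fun k : ℕ => Real.sin (k * u - d - u / 2)) h]
    refine Finset.sum_congr rfl fun k _ => ?_
    have e : ((k + 1 : ℕ) : ℝ) * u - d - u / 2 = (k * u - d) + u / 2 := by push_cast; ring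
    rw [e, Real.sin_add (k * u - d), Real.sin_sub (k * u - d)]
    ring
  have h2 : u / Real.pi ≤ Real.sin (u / 2) := by
    have := Real.mul_le_sin (x := u / 2) (by linarith) (by linarith)
    convert this using 1
    field_simp
  have h3 : 0 < u / Real.pi := by positivity
  have h4 : |2 * Real.sin (u / 2) * ∑ k ∈ Finset.Ico M j, Real.cos (k * u - d)| ≤ 2 := by
    rw [h1, abs_le]
    have a1 := Real.sin_le_one (j * u - d - u / 2)
    have a2 := Real.sin_le_one (M * u - d - u / 2)
    have a3 := Real.neg_one_le_sin (j * u - d - u / 2)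
    have a4 := Real.neg_one_le_sin (M * u - d - u / 2)
    constructor <;> linarith
  rw [abs_mul, abs_of_pos (by linarith)] at h4
  rw [le_div_iff₀ hu]
  have h5 : u / Real.pi * |∑ k ∈ Finset.Ico M j, Real.cos (k * u - d)| ≤ 1 := by
    have := mul_le_mul_of_nonneg_right h2 (abs_nonneg (∑ k ∈ Finset.Ico M j, Real.cos (k * u - d)))
    linarith
  have h6 : |∑ k ∈ Finset.Ico M j, Real.cos (k * u - d)| * u
      = Real.pi * (u / Real.pi * |∑ k ∈ Finset.Ico M j, Real.cos (k * u - d)|) := by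
    rw [← mul_assoc, mul_div_cancel₀ _ Real.pi_ne_zero, mul_comm]
  rw [h6]
  calc _ ≤ Real.pi * 1 := by gcongr
    _ = Real.pi := mul_one _

/-! ### Slow variation of the logarithm -/

theorem log_add_pos {K x : ℝ} (hK : 1 < K) (hx : 0 ≤ x) : 0 < Real.log (x + K) :=
  Real.log_pos (by linarith)

theorem log_add_le {K x y : ℝ} (hK : 1 < K) (hx : 0 < x) (hxy : x ≤ y) :
    Real.log (y + K) ≤ Real.log (x + K) + Real.log (y / x) := by
  have hy := hx.trans_le hxy
  rw [← Real.log_mul (by linarith) (by positivity)]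
  refine Real.log_le_log (by linarith) ?_
  rw [mul_div_assoc', le_div_iff₀ hx]
  nlinarith

theorem log_add_mono {K x y : ℝ} (hK : 1 < K) (hx : 0 ≤ x) (hxy : x ≤ y) :
    Real.log (x + K) ≤ Real.log (y + K) :=
  Real.log_le_log (by linarith) (by linarith)

theorem log_add_rpow_neg_anti {K x y γ : ℝ} (hK : 1 < K) (hγ : 0 ≤ γ) (hx : 0 ≤ x)
    (hxy : x ≤ y) : Real.log (y + K) ^ (-γ) ≤ Real.log (x + K) ^ (-γ) :=
  Real.rpow_le_rpow_of_nonpos (log_add_pos hK hx) (log_add_mono hK hx hxy) (by linarith)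

/-- A Potter-type bound. -/
theorem exists_log_rpow_le {K γ ε : ℝ} (hK : 1 < K) (hγ : 0 < γ) (hε : 0 < ε) :
    ∃ C : ℝ, 0 < C ∧ ∀ x y : ℝ, 0 < x → x ≤ y →
      Real.log (x + K) ^ (-γ) ≤ C * (y / x) ^ ε * Real.log (y + K) ^ (-γ) := by
  have hlK : 0 < Real.log K := Real.log_pos hK
  -- The bound is first proved for ln itself with exponent δ; raising it to the power γ turns δ into
  -- ε. The constant A below comes from ln z ≤ z^δ/δ and ln K ≤ ln(x + K).
  set δ := ε / γ with hδ
  have hδ0 : 0 < δ := by positivity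
  set A := 1 + 1 / (δ * Real.log K) with hA
  have hA0 : 0 < A := by positivity
  refine ⟨A ^ γ, by positivity, fun x y hx hxy => ?_⟩
  have hy := hx.trans_le hxy
  have hz : 1 ≤ y / x := (one_le_div hx).2 hxy
  have lx := log_add_pos hK hx.le
  have ly := log_add_pos hK hy.le
  have hKx : Real.log K ≤ Real.log (x + K) := Real.log_le_log (by linarith) (by linarith)
  have hzδ : 1 ≤ (y / x) ^ δ := Real.one_le_rpow hz hδ0.le
  have h1 : Real.log (y + K) ≤ A * (y / x) ^ δ * Real.log (x + K) := by
    refine (log_add_le hK hx hxy).trans ?_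
    have h2 : Real.log (y / x) ≤ (y / x) ^ δ / δ := Real.log_le_rpow_div (by positivity) hδ0
    have h3 : (y / x) ^ δ / δ ≤ (y / x) ^ δ * (1 / (δ * Real.log K)) * Real.log (x + K) := by
      have : (y / x) ^ δ / δ = (y / x) ^ δ * (1 / (δ * Real.log K)) * Real.log K := by
        field_simp
      rw [this]
      gcongr
    have h4 : Real.log (x + K) ≤ (y / x) ^ δ * Real.log (x + K) :=
      le_mul_of_one_le_left lx.le hzδ
    calc _ ≤ (y / x) ^ δ * Real.log (x + K)
          + (y / x) ^ δ * (1 / (δ * Real.log K)) * Real.log (x + K) := by linarith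
      _ = _ := by rw [hA]; ring
  have h5 : Real.log (y + K) ^ γ ≤ A ^ γ * (y / x) ^ ε * Real.log (x + K) ^ γ := by
    refine (Real.rpow_le_rpow ly.le h1 hγ.le).trans_eq ?_
    rw [Real.mul_rpow (by positivity) lx.le, Real.mul_rpow hA0.le (by positivity),
      ← Real.rpow_mul (by positivity), hδ, div_mul_cancel₀ _ hγ.ne']
  rw [Real.rpow_neg lx.le, Real.rpow_neg ly.le, ← div_eq_mul_inv, le_div_iff₀ (by positivity),
    inv_mul_le_iff₀ (by positivity)]
  linarith

/-- The logarithmic derivative s/x - γ/((x + K) ln(x + K)) is nonnegative once ln(x + K) ≥ γ/s. The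
proof replaces differentiation by 1 + z ≤ e^z. -/
theorem rpow_mul_log_rpow_mono {K γ s x y : ℝ} (hK : 1 < K) (hγ : 0 < γ) (hs : 0 < s)
    (hx : Real.exp (γ / s) ≤ x) (hxy : x ≤ y) :
    x ^ s * Real.log (x + K) ^ (-γ) ≤ y ^ s * Real.log (y + K) ^ (-γ) := by
  have hx0 : 0 < x := (Real.exp_pos _).trans_le hx
  have hy0 := hx0.trans_le hxy
  have lx := log_add_pos hK hx0.le
  have ly := log_add_pos hK hy0.le
  have hl : γ / s ≤ Real.log (x + K) := by
    rw [Real.le_log_iff_exp_le (by linarith)]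
    linarith
  have hz : 0 ≤ Real.log (y / x) := Real.log_nonneg ((one_le_div hx0).2 hxy)
  have h1 : Real.log (y + K) ≤ Real.log (x + K) * Real.exp (s / γ * Real.log (y / x)) := by
    have h2 := Real.add_one_le_exp (s / γ * Real.log (y / x))
    have h3 : Real.log (y / x) ≤ Real.log (x + K) * (s / γ * Real.log (y / x)) := by
      have : Real.log (y / x) = γ / s * (s / γ * Real.log (y / x)) := by field_simp
      calc _ = γ / s * (s / γ * Real.log (y / x)) := this
        _ ≤ _ := by gcongr
    calc _ ≤ _ := log_add_le hK hx0 hxy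
      _ ≤ Real.log (x + K) * (s / γ * Real.log (y / x) + 1) := by linarith
      _ ≤ _ := by gcongr
  have h5 : Real.log (y + K) ^ γ ≤ Real.log (x + K) ^ γ * (y / x) ^ s := by
    refine (Real.rpow_le_rpow ly.le h1 hγ.le).trans_eq ?_
    rw [Real.mul_rpow lx.le (Real.exp_pos _).le, ← Real.exp_mul,
      Real.rpow_def_of_pos (by positivity : 0 < y / x)]
    congr 2
    field_simp
  rw [Real.div_rpow hy0.le hx0.le, mul_div_assoc', le_div_iff₀ (by positivity)] at h5
  rw [Real.rpow_neg lx.le, Real.rpow_neg ly.le, ← div_eq_mul_inv, ← div_eq_mul_inv,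
    div_le_div_iff₀ (by positivity) (by positivity)]
  linarith

/-! ### Sums of powers and logarithms -/

/-- Induction; the step is Bernoulli's inequality for (1 - 1/(M+1))^(1-a). -/
theorem sum_rpow_neg_le {a : ℝ} (ha : 0 ≤ a) (ha1 : a < 1) (M : ℕ) :
    ∑ k ∈ Finset.Ico 1 (M + 1), (k : ℝ) ^ (-a) ≤ (M : ℝ) ^ (1 - a) / (1 - a) := by
  have h1a : 0 < 1 - a := by linarith
  induction M with
  | zero => simp [Real.zero_rpow h1a.ne']
  | succ M ih =>
    rw [Finset.sum_Ico_succ_top (by omega)]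
    have hp : (0 : ℝ) < (M : ℝ) + 1 := by positivity
    have hb := rpow_one_add_le_one_add_mul_self (s := -1 / ((M : ℝ) + 1)) (p := 1 - a)
      (by rw [le_div_iff₀ hp]; linarith [(Nat.cast_nonneg M : (0 : ℝ) ≤ M)]) h1a.le (by linarith)
    have e : 1 + -1 / ((M : ℝ) + 1) = M / (M + 1) := by field_simp; ring
    rw [e, Real.div_rpow (by positivity) hp.le, div_le_iff₀ (by positivity)] at hb
    have e2 : ((M : ℝ) + 1) ^ (1 - a) = (M + 1) * ((M : ℝ) + 1) ^ (-a) := by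
      rw [sub_eq_add_neg, Real.rpow_add hp, Real.rpow_one]
    have h3 : (1 - a) * ((M : ℝ) + 1) ^ (-a) ≤ ((M : ℝ) + 1) ^ (1 - a) - (M : ℝ) ^ (1 - a) := by
      have : (1 + (1 - a) * (-1 / ((M : ℝ) + 1))) * ((M : ℝ) + 1) ^ (1 - a)
          = ((M : ℝ) + 1) ^ (1 - a) - (1 - a) * ((M : ℝ) + 1) ^ (-a) := by
        rw [e2]; field_simp; ring
      linarith
    push_cast
    rw [le_div_iff₀ h1a] at ih ⊢
    linarith

theorem sum_rpow_neg_le' {a : ℝ} (ha : 0 ≤ a) (ha1 : a < 1) (M : ℕ) :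
    ∑ k ∈ Finset.Ico 1 M, (k : ℝ) ^ (-a) ≤ (M : ℝ) ^ (1 - a) / (1 - a) := by
  refine le_trans ?_ (sum_rpow_neg_le ha ha1 M)
  exact Finset.sum_le_sum_of_subset_of_nonneg (Finset.Ico_subset_Ico_right (by omega))
    fun _ _ _ => by positivity

/-- The Potter bound moves the logarithm from k to M at the cost of (M/k)^ε. With ε = (1-a)/2 the
remaining exponent a + ε is still below 1. -/
theorem exists_sum_rpow_mul_log_le {a K γ : ℝ} (ha : 0 ≤ a) (ha1 : a < 1) (hK : 1 < K)
    (hγ : 0 < γ) : ∃ C : ℝ, 0 < C ∧ ∀ M : ℕ,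
      ∑ k ∈ Finset.Ico 1 M, (k : ℝ) ^ (-a) * Real.log (k + K) ^ (-γ)
        ≤ C * ((M : ℝ) ^ (1 - a) * Real.log (M + K) ^ (-γ)) := by
  obtain ⟨C, hC, h⟩ := exists_log_rpow_le hK hγ (ε := (1 - a) / 2) (by linarith)
  set ε := (1 - a) / 2 with hε
  have hε0 : 0 < ε := by rw [hε]; linarith
  refine ⟨C / (1 - (a + ε)), div_pos hC (by rw [hε]; linarith), fun M => ?_⟩
  rcases Nat.eq_zero_or_pos M with rfl | hM
  · simp [Real.zero_rpow (by linarith : 1 - a ≠ 0)]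
  have hM' : (0 : ℝ) < M := by exact_mod_cast hM
  have hl := log_add_pos hK hM'.le
  calc _ ≤ ∑ k ∈ Finset.Ico 1 M, C * (M : ℝ) ^ ε * Real.log (M + K) ^ (-γ) * (k : ℝ) ^ (-(a + ε)) := by
        refine Finset.sum_le_sum fun k hk => ?_
        have hk := Finset.mem_Ico.1 hk
        have hk' : (0 : ℝ) < k := by exact_mod_cast hk.1
        have := h k M hk' (by exact_mod_cast hk.2.le)
        calc _ ≤ (k : ℝ) ^ (-a) * (C * ((M : ℝ) / k) ^ ε * Real.log (M + K) ^ (-γ)) := by gcongr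
          _ = _ := by
            rw [Real.div_rpow hM'.le hk'.le, neg_add, Real.rpow_add hk', Real.rpow_neg hk'.le ε]
            ring
    _ = C * (M : ℝ) ^ ε * Real.log (M + K) ^ (-γ) * ∑ k ∈ Finset.Ico 1 M, (k : ℝ) ^ (-(a + ε)) := by
        rw [Finset.mul_sum]
    _ ≤ C * (M : ℝ) ^ ε * Real.log (M + K) ^ (-γ) * ((M : ℝ) ^ (1 - (a + ε)) / (1 - (a + ε))) := by
        gcongr
        exact sum_rpow_neg_le' (by linarith) (by rw [hε]; linarith) M
    _ = _ := by
        have : (M : ℝ) ^ (1 - a) = (M : ℝ) ^ ε * (M : ℝ) ^ (1 - (a + ε)) := by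
          rw [← Real.rpow_add hM']; ring_nf
        rw [this]
        ring

/-- The Potter bound with exponent s is paid for exactly by the factor (k/n)^s. -/
theorem exists_sum_rpow_mul_rpow_mul_log_le {a K γ s : ℝ} (ha : 0 ≤ a) (ha1 : a < 1) (hK : 1 < K)
    (hγ : 0 < γ) (hs : 0 < s) : ∃ C : ℝ, 0 < C ∧ ∀ n M : ℕ, M ≤ n →
      ∑ k ∈ Finset.Ico 1 M, ((k : ℝ) / n) ^ s * ((k : ℝ) ^ (-a) * Real.log (k + K) ^ (-γ))
        ≤ C * (Real.log (n + K) ^ (-γ) * (M : ℝ) ^ (1 - a)) := by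
  obtain ⟨C, hC, h⟩ := exists_log_rpow_le hK hγ hs
  refine ⟨C / (1 - a), div_pos hC (by linarith), fun n M hMn => ?_⟩
  have hl := log_add_pos hK (Nat.cast_nonneg n : (0 : ℝ) ≤ n)
  calc _ ≤ ∑ k ∈ Finset.Ico 1 M, C * Real.log (n + K) ^ (-γ) * (k : ℝ) ^ (-a) := by
        refine Finset.sum_le_sum fun k hk => ?_
        have hk := Finset.mem_Ico.1 hk
        have hk' : (0 : ℝ) < k := by exact_mod_cast hk.1
        have hkn : (k : ℝ) ≤ n := by exact_mod_cast hk.2.le.trans hMn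
        have hn' := hk'.trans_le hkn
        calc _ ≤ ((k : ℝ) / n) ^ s * ((k : ℝ) ^ (-a)
                * (C * ((n : ℝ) / k) ^ s * Real.log (n + K) ^ (-γ))) := by
              have := h k n hk' hkn
              gcongr
          _ = _ := by
            have : ((k : ℝ) / n) ^ s * ((n : ℝ) / k) ^ s = 1 := by
              rw [← Real.mul_rpow (by positivity) (by positivity)]
              have : (k : ℝ) / n * (n / k) = 1 := by field_simp
              rw [this, Real.one_rpow]
            linear_combination (k : ℝ) ^ (-a) * C * Real.log (n + K) ^ (-γ) * this
    _ = C * Real.log (n + K) ^ (-γ) * ∑ k ∈ Finset.Ico 1 M, (k : ℝ) ^ (-a) := by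
        rw [Finset.mul_sum]
    _ ≤ C * Real.log (n + K) ^ (-γ) * ((M : ℝ) ^ (1 - a) / (1 - a)) := by
        gcongr
        exact sum_rpow_neg_le' ha ha1 M
    _ = _ := by ring

theorem exists_sum_rpow_mul_inv_mul_log_le {K γ s : ℝ} (hK : 1 < K)
    (hγ : 0 < γ) (hs : 0 < s) : ∃ C : ℝ, 0 < C ∧ ∀ n : ℕ, 1 ≤ n →
      ∑ k ∈ Finset.Ico 1 n, ((k : ℝ) / n) ^ s * ((k : ℝ) ^ (-1 : ℝ) * Real.log (k + K) ^ (-γ))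
        ≤ C * Real.log (n + K) ^ (-γ) := by
  -- Since 2δ ≤ s, one factor (k/n)^δ softens k^(-1) to n^(-δ) k^(-(1-δ)) and the other plays the
  -- part of (k/n)^s in the preceding lemma.
  set δ := min s 1 / 2 with hδ
  have hδ0 : 0 < δ := by positivity
  have hδ1 : δ < 1 := by have := min_le_right s 1; rw [hδ]; linarith
  have hδs : 2 * δ ≤ s := by have := min_le_left s 1; rw [hδ]; linarith
  obtain ⟨C, hC, h⟩ := exists_sum_rpow_mul_rpow_mul_log_le (a := 1 - δ) (by linarith) (by linarith)
    hK hγ hδ0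
  refine ⟨C, hC, fun n hn => ?_⟩
  have hn' : (0 : ℝ) < n := by exact_mod_cast hn
  have hl := log_add_pos hK hn'.le
  calc _ ≤ ∑ k ∈ Finset.Ico 1 n, (n : ℝ) ^ (-δ) * (((k : ℝ) / n) ^ δ
            * ((k : ℝ) ^ (-(1 - δ)) * Real.log (k + K) ^ (-γ))) := by
        refine Finset.sum_le_sum fun k hk => ?_
        have hk := Finset.mem_Ico.1 hk
        have hk' : (0 : ℝ) < k := by exact_mod_cast hk.1
        have hkn : (k : ℝ) ≤ n := by exact_mod_cast hk.2.le
        have hlk := log_add_pos hK hk'.le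
        have h1 : ((k : ℝ) / n) ^ s ≤ ((k : ℝ) / n) ^ (2 * δ) :=
          Real.rpow_le_rpow_of_exponent_ge (by positivity) ((div_le_one hn').2 hkn) hδs
        calc _ ≤ ((k : ℝ) / n) ^ (2 * δ) * ((k : ℝ) ^ (-1 : ℝ) * Real.log (k + K) ^ (-γ)) := by
              gcongr
          _ = _ := by
            have e1 : ((k : ℝ) / n) ^ (2 * δ) = ((k : ℝ) / n) ^ δ * ((k : ℝ) ^ δ * (n : ℝ) ^ (-δ)) := by
              rw [two_mul, Real.rpow_add (by positivity), Real.rpow_neg hn'.le, ← div_eq_mul_inv,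
                ← Real.div_rpow hk'.le hn'.le]
            have e2 : (k : ℝ) ^ (-(1 - δ)) = (k : ℝ) ^ δ * (k : ℝ) ^ (-1 : ℝ) := by
              rw [← Real.rpow_add hk']; ring_nf
            rw [e1, e2]
            ring
    _ = (n : ℝ) ^ (-δ) * ∑ k ∈ Finset.Ico 1 n, ((k : ℝ) / n) ^ δ
            * ((k : ℝ) ^ (-(1 - δ)) * Real.log (k + K) ^ (-γ)) := by rw [Finset.mul_sum]
    _ ≤ (n : ℝ) ^ (-δ) * (C * (Real.log (n + K) ^ (-γ) * (n : ℝ) ^ (1 - (1 - δ)))) := by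
        gcongr
        exact h n n le_rfl
    _ = _ := by
        have : (n : ℝ) ^ (-δ) * (n : ℝ) ^ (1 - (1 - δ)) = 1 := by
          rw [← Real.rpow_add hn']
          simp
        linear_combination C * Real.log (n + K) ^ (-γ) * this

/-- Convexity of z^(1-γ): its graph lies above the tangent at y. -/
theorem log_rpow_sub_le {x y γ : ℝ} (hx : 0 < x) (hxy : x ≤ y) (hγ : 1 < γ) :
    (γ - 1) * (y ^ (-γ) * (y - x)) ≤ x ^ (1 - γ) - y ^ (1 - γ) := by
  have hy := hx.trans_le hxy
  have h1 : 1 + (1 - γ) * (x / y - 1) ≤ (x / y) ^ (1 - γ) := by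
    have h2 := Real.add_one_le_exp (Real.log (x / y) * (1 - γ))
    rw [Real.rpow_def_of_pos (by positivity)]
    have h3 := Real.log_le_sub_one_of_pos (by positivity : 0 < x / y)
    nlinarith
  have e : y ^ (1 - γ) = y * y ^ (-γ) := by
    rw [sub_eq_add_neg, Real.rpow_add hy, Real.rpow_one]
  rw [Real.div_rpow hx.le hy.le, le_div_iff₀ (by positivity), e] at h1
  rw [e]
  have : (1 + (1 - γ) * (x / y - 1)) * (y * y ^ (-γ))
      = y * y ^ (-γ) + (γ - 1) * (y ^ (-γ) * (y - x)) := by field_simp; ring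
  linarith

theorem exists_sum_inv_mul_log_le {K γ : ℝ} (hK : 1 < K) (hγ : 1 < γ) :
    ∃ C : ℝ, 0 < C ∧ ∀ n Q : ℕ, 1 ≤ n →
      ∑ k ∈ Finset.Ico n Q, ((k : ℝ) ^ (-1 : ℝ) * Real.log (k + K) ^ (-γ))
        ≤ C * Real.log (n + K) ^ (1 - γ) := by
  have hlK : 0 < Real.log K := Real.log_pos hK
  refine ⟨1 / Real.log K + (1 + K) / (γ - 1), add_pos (by positivity)
    (div_pos (by linarith) (by linarith)), fun n Q hn => ?_⟩
  have hn' : (1 : ℝ) ≤ n := by exact_mod_cast hn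
  have hl := log_add_pos hK (by linarith : (0 : ℝ) ≤ n)
  have hfirst : (n : ℝ) ^ (-1 : ℝ) * Real.log (n + K) ^ (-γ)
      ≤ 1 / Real.log K * Real.log (n + K) ^ (1 - γ) := by
    have h1 : (n : ℝ) ^ (-1 : ℝ) ≤ 1 := Real.rpow_le_one_of_one_le_of_nonpos hn' (by norm_num)
    have h2 : 1 ≤ 1 / Real.log K * Real.log (n + K) := by
      rw [one_div, inv_mul_eq_div, one_le_div hlK]
      exact Real.log_le_log (by linarith) (by linarith)
    rw [sub_eq_add_neg, Real.rpow_add hl, Real.rpow_one, ← mul_assoc]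
    gcongr
    linarith
  -- The term Q + 1 is charged to the drop of ln^(1-γ)(x + K) over [Q, Q+1], so the term k = n was
  -- treated apart. The factor 1 + K comes from Q + 1 + K ≤ (Q + 1)(1 + K).
  have hrest : ∀ Q, n ≤ Q → (γ - 1) / (1 + K) *
      ∑ k ∈ Finset.Ico (n + 1) (Q + 1), ((k : ℝ) ^ (-1 : ℝ) * Real.log (k + K) ^ (-γ))
        ≤ Real.log (n + K) ^ (1 - γ) - Real.log (Q + K) ^ (1 - γ) := by
    intro Q hQ
    induction Q, hQ using Nat.le_induction with
    | base => simp
    | succ Q hQ ih =>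
      rw [Finset.sum_Ico_succ_top (by omega), mul_add]
      have hQ0 : (0 : ℝ) ≤ Q := Nat.cast_nonneg Q
      have h1 := log_rpow_sub_le (log_add_pos hK hQ0)
        (log_add_mono hK hQ0 (by linarith : (Q : ℝ) ≤ Q + 1)) hγ
      have h2 : ((Q : ℝ) + 1) ^ (-1 : ℝ) / (1 + K)
          ≤ Real.log ((Q : ℝ) + 1 + K) - Real.log (Q + K) := by
        have h3 := Real.log_le_sub_one_of_pos
          (div_pos (by linarith) (by linarith) : 0 < ((Q : ℝ) + K) / (Q + 1 + K))
        rw [Real.log_div (by linarith) (by linarith)] at h3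
        have h4 : ((Q : ℝ) + K) / (Q + 1 + K) - 1 = - (1 / (Q + 1 + K)) := by
          field_simp; ring
        have h5 : ((Q : ℝ) + 1) ^ (-1 : ℝ) / (1 + K) ≤ 1 / (Q + 1 + K) := by
          rw [Real.rpow_neg_one, ← one_div, div_div]
          apply one_div_le_one_div_of_le (by linarith)
          nlinarith
        linarith
      have hlQ := log_add_pos hK (by linarith : (0 : ℝ) ≤ (Q : ℝ) + 1)
      have h6 : (γ - 1) / (1 + K) * (((Q : ℝ) + 1) ^ (-1 : ℝ) * Real.log ((Q : ℝ) + 1 + K) ^ (-γ))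
          ≤ (γ - 1) * (Real.log ((Q : ℝ) + 1 + K) ^ (-γ)
            * (Real.log ((Q : ℝ) + 1 + K) - Real.log (Q + K))) := by
        have : (γ - 1) / (1 + K) * (((Q : ℝ) + 1) ^ (-1 : ℝ) * Real.log ((Q : ℝ) + 1 + K) ^ (-γ))
          = (γ - 1) * (Real.log ((Q : ℝ) + 1 + K) ^ (-γ) * (((Q : ℝ) + 1) ^ (-1 : ℝ) / (1 + K))) := by
          ring
        rw [this]
        have : 0 ≤ γ - 1 := by linarith
        gcongr
      push_cast
      linarith
  have hnn : ∀ k : ℕ, 0 ≤ (k : ℝ) ^ (-1 : ℝ) * Real.log (k + K) ^ (-γ) := fun k =>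
    mul_nonneg (by positivity) (Real.rpow_nonneg (log_add_pos hK (Nat.cast_nonneg k)).le _)
  have h7 : ∑ k ∈ Finset.Ico n Q, ((k : ℝ) ^ (-1 : ℝ) * Real.log (k + K) ^ (-γ))
      ≤ ∑ k ∈ Finset.Ico n (n + Q + 1), ((k : ℝ) ^ (-1 : ℝ) * Real.log (k + K) ^ (-γ)) :=
    Finset.sum_le_sum_of_subset_of_nonneg (Finset.Ico_subset_Ico_right (by omega))
      fun k _ _ => hnn k
  rw [Finset.sum_eq_sum_Ico_succ_bot (by omega : n < n + Q + 1)] at h7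
  have h8 := hrest (n + Q) (by omega)
  have h9 : 0 ≤ Real.log ((n + Q : ℕ) + K) ^ (1 - γ) :=
    Real.rpow_nonneg (log_add_pos hK (Nat.cast_nonneg _)).le _
  have hc : 0 < (γ - 1) / (1 + K) := div_pos (by linarith) (by linarith)
  have h10 : ∑ k ∈ Finset.Ico (n + 1) (n + Q + 1), ((k : ℝ) ^ (-1 : ℝ) * Real.log (k + K) ^ (-γ))
      ≤ (1 + K) / (γ - 1) * Real.log (n + K) ^ (1 - γ) := by
    rw [← inv_div, inv_mul_eq_div, le_div_iff₀' hc]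
    linarith
  rw [add_mul]
  linarith

/-! ### Kernels of the deviations -/

/-- The weight `x^{-a} ln^{-γ}(x + K)`. -/
def powLog (a γ K x : ℝ) : ℝ := x ^ (-a) * Real.log (x + K) ^ (-γ)

theorem psiLog_eq_powLog (p γ K x : ℝ) : psiLog p γ K x = powLog (1 / p) γ K x := rfl

theorem powLog_nonneg {a γ K x : ℝ} (hK : 1 < K) (hx : 0 ≤ x) : 0 ≤ powLog a γ K x :=
  mul_nonneg (Real.rpow_nonneg hx _) (Real.rpow_nonneg (log_add_pos hK hx).le _)

theorem powLog_pos {a γ K x : ℝ} (hK : 1 < K) (hx : 0 < x) : 0 < powLog a γ K x :=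
  mul_pos (Real.rpow_pos_of_pos hx _) (Real.rpow_pos_of_pos (log_add_pos hK hx.le) _)

theorem powLog_anti {a γ K x y : ℝ} (ha : 0 ≤ a) (hγ : 0 ≤ γ) (hK : 1 < K) (hx : 0 < x)
    (hxy : x ≤ y) : powLog a γ K y ≤ powLog a γ K x :=
  mul_le_mul (Real.rpow_le_rpow_of_nonpos hx hxy (by linarith))
    (log_add_rpow_neg_anti hK hγ hx.le hxy)
    (Real.rpow_nonneg (log_add_pos hK (hx.le.trans hxy)).le _) (Real.rpow_nonneg hx.le _)

/-- The multipliers of the difference between de la Vallée-Poussin means and Zygmund sums. -/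
def devCoef (s : ℝ) (n N k : ℕ) : ℝ := if k < n then ((k : ℝ) / n) ^ s else vpCoef N k

theorem devCoef_nonneg (s : ℝ) (n N k : ℕ) : 0 ≤ devCoef s n N k := by
  unfold devCoef
  split_ifs
  · positivity
  · exact vpCoef_nonneg N k

theorem devCoef_le_one {s : ℝ} (hs : 0 < s) (n N k : ℕ) : devCoef s n N k ≤ 1 := by
  unfold devCoef
  split_ifs with h
  · exact Real.rpow_le_one (by positivity)
      (div_le_one_of_le₀ (by exact_mod_cast h.le) (by positivity)) hs.le
  · exact vpCoef_le_one N k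

/-- The kernel of the difference between de la Vallée-Poussin means and Zygmund sums. -/
def devKernel (a γ K s : ℝ) (n N : ℕ) (d u : ℝ) : ℝ :=
  ∑ k ∈ Finset.Ico 1 (2 * N), devCoef s n N k * powLog a γ K k * Real.cos (k * u - d)

theorem continuous_devKernel (a γ K s : ℝ) (n N : ℕ) (d : ℝ) :
    Continuous (devKernel a γ K s n N d) := by
  unfold devKernel
  fun_prop

theorem devKernel_periodic (a γ K s : ℝ) (n N : ℕ) (d : ℝ) :
    Function.Periodic (devKernel a γ K s n N d) (2 * Real.pi) := by
  intro u
  refine Finset.sum_congr rfl fun k _ => ?_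
  rw [show (k : ℝ) * (u + 2 * Real.pi) - d = k * u - d + k * (2 * Real.pi) by ring,
    Real.cos_add_nat_mul_two_pi]

theorem devKernel_neg (a γ K s : ℝ) (n N : ℕ) (d u : ℝ) :
    devKernel a γ K s n N d (-u) = devKernel a γ K s n N (-d) u := by
  refine Finset.sum_congr rfl fun k _ => ?_
  rw [← Real.cos_neg]
  congr 2
  ring

/-- Padding with zero terms allows the sum to be cut at any M without comparing M with 2N. -/
theorem devKernel_eq_sum {a γ K s : ℝ} {n N Q : ℕ} (hN : 1 ≤ N) (hn : n ≤ N) (hQ : 2 * N ≤ Q)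
    (d u : ℝ) : devKernel a γ K s n N d u
      = ∑ k ∈ Finset.Ico 1 Q, devCoef s n N k * powLog a γ K k * Real.cos (k * u - d) := by
  refine Finset.sum_subset (Finset.Ico_subset_Ico_right hQ) fun k hk hk' => ?_
  have hk2 : 2 * N ≤ k := by
    by_contra h
    exact hk' (Finset.mem_Ico.2 ⟨(Finset.mem_Ico.1 hk).1, by omega⟩)
  rw [devCoef, if_neg (by omega), vpCoef_eq_zero hN hk2]
  simp

theorem abs_sum_devCoef_le {a γ K s : ℝ} (hK : 1 < K) (n N A B : ℕ) (d u : ℝ) :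
    |∑ k ∈ Finset.Ico A B, devCoef s n N k * powLog a γ K k * Real.cos (k * u - d)|
      ≤ ∑ k ∈ Finset.Ico A B, devCoef s n N k * powLog a γ K k := by
  refine (Finset.abs_sum_le_sum_abs _ _).trans (Finset.sum_le_sum fun k _ => ?_)
  have h := mul_nonneg (devCoef_nonneg s n N k) (powLog_nonneg (a := a) (γ := γ) hK
    (Nat.cast_nonneg k))
  rw [abs_mul, abs_of_nonneg h]
  exact mul_le_of_le_one_right h (Real.abs_cos_le_one _)

/-- From n on, the coefficients are a product of two nonnegative decreasing sequences, so Abel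
summation leaves only the first one, independently of N and Q. -/
theorem abs_sum_devCoef_tail_le {a γ K s : ℝ} (ha : 0 ≤ a) (hγ : 0 ≤ γ) (hK : 1 < K)
    {n N M : ℕ} (hM : 1 ≤ M) (hnM : n ≤ M) (Q : ℕ) (d : ℝ) {u : ℝ} (hu : 0 < u)
    (hu' : u ≤ Real.pi) :
    |∑ k ∈ Finset.Ico M Q, devCoef s n N k * powLog a γ K k * Real.cos (k * u - d)|
      ≤ powLog a γ K M * (Real.pi / u) := by
  have hM0 : (0 : ℝ) < M := by exact_mod_cast hM
  have hpM := powLog_nonneg (a := a) (γ := γ) hK hM0.le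
  rcases le_total Q M with h | h
  · rw [Finset.Ico_eq_empty_of_le h, Finset.sum_empty, abs_zero]
    positivity
  refine (abs_sum_Ico_mul_le_of_antitone (c := fun k => devCoef s n N k * powLog a γ K k) h
    (fun k hk _ => ?_) ?_ fun j _ _ => abs_sum_cos_le M j d hu hu').trans ?_
  · simp only [devCoef]
    rw [if_neg (by omega), if_neg (by omega)]
    have hk0 : (0 : ℝ) < k := by exact_mod_cast hM.trans hk
    exact mul_le_mul (vpCoef_antitone N k.le_succ) (powLog_anti ha hγ hK hk0 (by simp))
      (powLog_nonneg hK (Nat.cast_nonneg _)) (vpCoef_nonneg N k)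
  · exact mul_nonneg (devCoef_nonneg _ _ _ _) (powLog_nonneg hK (Nat.cast_nonneg _))
  · simp only [devCoef]
    rw [if_neg (by omega)]
    have := mul_le_of_le_one_left hpM (vpCoef_le_one N M)
    gcongr

theorem inv_rpow_neg_mul_div {a u : ℝ} (hu : 0 < u) :
    (1 / u) ^ (-a) * (Real.pi / u) = Real.pi * u ^ (a - 1) := by
  rw [one_div, Real.inv_rpow hu.le, Real.rpow_neg hu.le, inv_inv, Real.rpow_sub_one hu.ne']
  ring

/-- The cut is at M = ⌈1/u⌉, which is at least n: below it cosines are bounded by 1, above it Abel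
summation applies. -/
theorem abs_devKernel_le_of_small {a γ K : ℝ} (ha : 0 ≤ a) (ha1 : a < 1) (hK : 1 < K)
    (hγ : 0 < γ) : ∃ C : ℝ, 0 < C ∧ ∀ (s : ℝ) (n N : ℕ) (d u : ℝ), 0 < s → 1 ≤ n → n ≤ N →
      0 < u → u ≤ 1 / n →
      |devKernel a γ K s n N d u| ≤ C * (u ^ (a - 1) * Real.log (1 / u + K) ^ (-γ)) := by
  obtain ⟨C, hC, h⟩ := exists_sum_rpow_mul_log_le ha ha1 hK hγ
  refine ⟨C * 2 ^ (1 - a) + Real.pi, by positivity, fun s n N d u hs hn hnN hu hun => ?_⟩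
  have hn' : (1 : ℝ) ≤ n := by exact_mod_cast hn
  have hu1 : u ≤ 1 := hun.trans (by rw [div_le_one (by linarith)]; exact hn')
  have hupi : u ≤ Real.pi := by linarith [Real.pi_gt_three]
  have h1u : 1 ≤ 1 / u := (one_le_div hu).2 hu1
  have hnu : (n : ℝ) ≤ 1 / u := by rwa [le_div_iff₀ hu, ← le_div_iff₀' (by linarith)]
  set M := ⌈1 / u⌉₊ with hM
  have hM1 : 1 / u ≤ M := Nat.le_ceil _
  have hM2 : (M : ℝ) ≤ 2 / u := by
    have := (Nat.ceil_lt_add_one (by positivity : 0 ≤ 1 / u)).le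
    have h2 : 2 / u = 1 / u + 1 / u := by ring
    rw [h2]
    linarith
  have hnM : n ≤ M := by exact_mod_cast hnu.trans hM1
  have hM0 : (0 : ℝ) < M := by linarith
  have hl := log_add_pos hK (by linarith : 0 ≤ 1 / u)
  have hlM := log_add_rpow_neg_anti hK hγ.le (by linarith : 0 ≤ 1 / u) hM1
  have hlMp := log_add_pos hK hM0.le
  rw [devKernel_eq_sum (Q := 2 * N + M) (hn.trans hnN) hnN (by omega),
    ← Finset.sum_Ico_consecutive _ (hn.trans hnM) (by omega : M ≤ 2 * N + M)]
  have hhead : |∑ k ∈ Finset.Ico 1 M, devCoef s n N k * powLog a γ K k * Real.cos (k * u - d)|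
      ≤ C * 2 ^ (1 - a) * (u ^ (a - 1) * Real.log (1 / u + K) ^ (-γ)) := by
    calc _ ≤ _ := abs_sum_devCoef_le hK n N 1 M d u
      _ ≤ ∑ k ∈ Finset.Ico 1 M, powLog a γ K k := Finset.sum_le_sum fun k _ =>
          mul_le_of_le_one_left (powLog_nonneg hK (Nat.cast_nonneg k)) (devCoef_le_one hs n N k)
      _ ≤ C * ((M : ℝ) ^ (1 - a) * Real.log (M + K) ^ (-γ)) := h M
      _ ≤ C * ((2 / u) ^ (1 - a) * Real.log (1 / u + K) ^ (-γ)) := by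
          have := Real.rpow_le_rpow hM0.le hM2 (by linarith : 0 ≤ 1 - a)
          gcongr
      _ = _ := by
          rw [Real.div_rpow (by norm_num) hu.le, ← neg_sub 1 a, Real.rpow_neg hu.le]
          ring
  have htail : |∑ k ∈ Finset.Ico M (2 * N + M),
      devCoef s n N k * powLog a γ K k * Real.cos (k * u - d)|
      ≤ Real.pi * (u ^ (a - 1) * Real.log (1 / u + K) ^ (-γ)) := by
    refine (abs_sum_devCoef_tail_le ha hγ.le hK (hn.trans hnM) hnM _ d hu hupi).trans ?_
    calc _ ≤ powLog a γ K (1 / u) * (Real.pi / u) := by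
          have := powLog_anti ha hγ.le hK (by linarith : 0 < 1 / u) hM1
          gcongr
      _ = ((1 / u) ^ (-a) * (Real.pi / u)) * Real.log (1 / u + K) ^ (-γ) := by
          rw [powLog]; ring
      _ = _ := by rw [inv_rpow_neg_mul_div hu]; ring
  refine (abs_add_le _ _).trans ?_
  rw [add_mul]
  exact add_le_add hhead htail

/-- Here 1/u ≤ n, and there are three ranges: a trivial estimate up to about κ/u, double Abel
summation from there to n against the factors (k/n)^s ln^(-γ)(k + K) and k^(-a), and single Abel
summation beyond n. -/
theorem abs_devKernel_le_of_large {a γ K s : ℝ} (ha : 0 ≤ a) (ha1 : a < 1) (hK : 1 < K)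
    (hγ : 0 < γ) (hs : 0 < s) : ∃ C : ℝ, 0 < C ∧ ∀ (n N : ℕ) (d u : ℝ), 1 ≤ n → n ≤ N →
      1 / n ≤ u → u ≤ Real.pi →
      |devKernel a γ K s n N d u| ≤ C * (u ^ (a - 1) * Real.log (n + K) ^ (-γ)) := by
  obtain ⟨C, hC, h⟩ := exists_sum_rpow_mul_rpow_mul_log_le ha ha1 hK hγ hs
  -- As u ≤ π, this forces κ/u ≥ e^(γ/s), the threshold beyond which x^s ln^(-γ)(x + K) increases.
  set κ := Real.pi * Real.exp (γ / s) with hκ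
  have hκ0 : 0 < κ := by positivity
  have hκ1 : 1 ≤ κ := by
    have h1 : 1 ≤ Real.exp (γ / s) := Real.one_le_exp (by positivity)
    nlinarith [Real.pi_gt_three]
  refine ⟨C * (κ + Real.pi) ^ (1 - a) + 2 * Real.pi + Real.pi, by positivity,
    fun n N d u hn hnN hun hupi => ?_⟩
  have hn' : (0 : ℝ) < n := by exact_mod_cast hn
  have hu : 0 < u := lt_of_lt_of_le (by positivity) hun
  have hnu : 1 / u ≤ n := by rwa [div_le_iff₀ hu, ← div_le_iff₀' hn']
  have h1u : 0 < 1 / u := by positivity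
  set M := ⌈κ / u⌉₊ with hM
  have hMκ : κ / u ≤ M := Nat.le_ceil _
  have hM1 : 1 / u ≤ M := le_trans (by gcongr) hMκ
  have hMe : Real.exp (γ / s) ≤ M := by
    refine le_trans ?_ hMκ
    rw [le_div_iff₀ hu, hκ, mul_comm]
    gcongr
  have hM2 : (M : ℝ) ≤ (κ + Real.pi) / u := by
    have := (Nat.ceil_lt_add_one (by positivity : 0 ≤ κ / u)).le
    have h2 : 1 ≤ Real.pi / u := (one_le_div hu).2 hupi
    rw [add_div]
    linarith
  have hM0 : (0 : ℝ) < M := by linarith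
  have hM0' : 1 ≤ M := by exact_mod_cast hM0
  have hl := log_add_pos hK hn'.le
  -- M may exceed n; then the middle range is empty.
  set M' := min M n with hM'
  have hM'1 : 1 ≤ M' := le_min hM0' hn
  have hM'n : M' ≤ n := min_le_right _ _
  rw [devKernel, ← Finset.sum_Ico_consecutive _ hn (by omega : n ≤ 2 * N),
    ← Finset.sum_Ico_consecutive _ hM'1 hM'n]
  have hhead : |∑ k ∈ Finset.Ico 1 M', devCoef s n N k * powLog a γ K k * Real.cos (k * u - d)|
      ≤ C * (κ + Real.pi) ^ (1 - a) * (u ^ (a - 1) * Real.log (n + K) ^ (-γ)) := by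
    calc _ ≤ _ := abs_sum_devCoef_le hK n N 1 M' d u
      _ = ∑ k ∈ Finset.Ico 1 M', ((k : ℝ) / n) ^ s * ((k : ℝ) ^ (-a) * Real.log (k + K) ^ (-γ)) := by
          refine Finset.sum_congr rfl fun k hk => ?_
          rw [devCoef, if_pos ((Finset.mem_Ico.1 hk).2.trans_le hM'n), powLog]
      _ ≤ C * (Real.log (n + K) ^ (-γ) * (M' : ℝ) ^ (1 - a)) := h n M' hM'n
      _ ≤ C * (Real.log (n + K) ^ (-γ) * ((κ + Real.pi) / u) ^ (1 - a)) := by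
          have h3 : (M' : ℝ) ≤ M := by exact_mod_cast min_le_left _ _
          have := Real.rpow_le_rpow (Nat.cast_nonneg M') (h3.trans hM2) (by linarith : 0 ≤ 1 - a)
          gcongr
      _ = _ := by
          rw [Real.div_rpow (by positivity) hu.le, ← neg_sub 1 a, Real.rpow_neg hu.le]
          ring
  have hmid : |∑ k ∈ Finset.Ico M' n, devCoef s n N k * powLog a γ K k * Real.cos (k * u - d)|
      ≤ 2 * Real.pi * (u ^ (a - 1) * Real.log (n + K) ^ (-γ)) := by
    rcases le_total n M with hMn | hMn
    · rw [hM', min_eq_right hMn, Finset.Ico_self, Finset.sum_empty, abs_zero]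
      positivity
    rw [hM', min_eq_left hMn]
    have h4 := abs_sum_Ico_mul_mul_le (a := fun k : ℕ => ((k : ℝ) / n) ^ s * Real.log (k + K) ^ (-γ))
      (b := fun k : ℕ => (k : ℝ) ^ (-a)) hMn (fun k hk _ => ?_)
      (mul_nonneg (by positivity) (Real.rpow_nonneg (log_add_pos hK hM0.le).le _))
      (fun k hk _ => ?_) (by positivity) fun j _ _ => abs_sum_cos_le M j d hu hupi
    · calc _ = |∑ k ∈ Finset.Ico M n, (k : ℝ) ^ (-a)
              * (((k : ℝ) / n) ^ s * Real.log (k + K) ^ (-γ) * Real.cos (k * u - d))| := by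
            congr 1
            refine Finset.sum_congr rfl fun k hk => ?_
            rw [devCoef, if_pos (Finset.mem_Ico.1 hk).2, powLog]
            ring
        _ ≤ _ := h4
        _ ≤ (1 / u) ^ (-a) * (2 * (((n : ℝ) / n) ^ s * Real.log (n + K) ^ (-γ))
              * (Real.pi / u)) := by
            have := Real.rpow_le_rpow_of_nonpos h1u hM1 (by linarith : -a ≤ 0)
            gcongr
        _ = 2 * ((1 / u) ^ (-a) * (Real.pi / u)) * Real.log (n + K) ^ (-γ) := by
            rw [div_self hn'.ne', Real.one_rpow]
            ring
        _ = _ := by rw [inv_rpow_neg_mul_div hu]; ring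
    · have hk' : (M : ℝ) ≤ k := by exact_mod_cast hk
      have := rpow_mul_log_rpow_mono hK hγ hs (hMe.trans hk') (by linarith : (k : ℝ) ≤ (k : ℝ) + 1)
      simp only [Nat.cast_add, Nat.cast_one]
      rw [Real.div_rpow (by positivity) hn'.le, Real.div_rpow (by positivity) hn'.le,
        div_mul_eq_mul_div, div_mul_eq_mul_div]
      gcongr
    · have hk' : (M : ℝ) ≤ k := by exact_mod_cast hk
      exact Real.rpow_le_rpow_of_nonpos (by linarith) (by simp) (by linarith)
  have htail : |∑ k ∈ Finset.Ico n (2 * N),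
      devCoef s n N k * powLog a γ K k * Real.cos (k * u - d)|
      ≤ Real.pi * (u ^ (a - 1) * Real.log (n + K) ^ (-γ)) := by
    refine (abs_sum_devCoef_tail_le ha hγ.le hK hn le_rfl _ d hu hupi).trans ?_
    calc _ = ((n : ℝ) ^ (-a) * (Real.pi / u)) * Real.log (n + K) ^ (-γ) := by
          rw [powLog]; ring
      _ ≤ ((1 / u) ^ (-a) * (Real.pi / u)) * Real.log (n + K) ^ (-γ) := by
          have := Real.rpow_le_rpow_of_nonpos h1u hnu (by linarith : -a ≤ 0)
          gcongr
      _ = _ := by rw [inv_rpow_neg_mul_div hu]; ring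
  refine (abs_add_le _ _).trans ?_
  rw [add_mul, add_mul]
  exact add_le_add ((abs_add_le _ _).trans (add_le_add hhead hmid)) htail

theorem abs_sum_devCoef_head_le {γ K s : ℝ} (hK : 1 < K) (hγ : 0 < γ) (hs : 0 < s) :
    ∃ C : ℝ, 0 < C ∧ ∀ (n N : ℕ) (d u : ℝ), 1 ≤ n →
      |∑ k ∈ Finset.Ico 1 n, devCoef s n N k * powLog 1 γ K k * Real.cos (k * u - d)|
        ≤ C * Real.log (n + K) ^ (-γ) := by
  obtain ⟨C, hC, h⟩ := exists_sum_rpow_mul_inv_mul_log_le hK hγ hs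
  refine ⟨C, hC, fun n N d u hn => ?_⟩
  refine (abs_sum_devCoef_le hK n N 1 n d u).trans (le_trans (le_of_eq ?_) (h n hn))
  refine Finset.sum_congr rfl fun k hk => ?_
  rw [devCoef, if_pos (Finset.mem_Ico.1 hk).2, powLog]

theorem abs_devKernel_one_le {γ K s : ℝ} (hK : 1 < K) (hγ : 1 < γ) (hs : 0 < s) :
    ∃ C : ℝ, 0 < C ∧ ∀ (n N : ℕ) (d u : ℝ), 1 ≤ n → n ≤ N →
      |devKernel 1 γ K s n N d u| ≤ C * Real.log (n + K) ^ (1 - γ) := by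
  obtain ⟨C, hC, h⟩ := abs_sum_devCoef_head_le (s := s) hK (by linarith : 0 < γ) hs
  obtain ⟨C', hC', h'⟩ := exists_sum_inv_mul_log_le hK hγ
  have hlK : 0 < Real.log K := Real.log_pos hK
  refine ⟨C / Real.log K + C', by positivity, fun n N d u hn hnN => ?_⟩
  have hn' : (0 : ℝ) < n := by exact_mod_cast hn
  have hl := log_add_pos hK hn'.le
  rw [devKernel, ← Finset.sum_Ico_consecutive _ hn (by omega : n ≤ 2 * N), add_mul]
  refine (abs_add_le _ _).trans (add_le_add ?_ ?_)
  · refine (h n N d u hn).trans ?_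
    rw [sub_eq_add_neg, Real.rpow_add hl, Real.rpow_one, ← mul_assoc]
    have h2 : 1 ≤ Real.log (n + K) / Real.log K := by
      rw [one_le_div hlK]
      exact Real.log_le_log (by linarith) (by linarith)
    have : C ≤ C / Real.log K * Real.log (n + K) := by
      calc C = C * 1 := (mul_one C).symm
        _ ≤ C * (Real.log (n + K) / Real.log K) := by gcongr
        _ = _ := by ring
    gcongr
  · refine (abs_sum_devCoef_le hK n N n _ d u).trans (le_trans (Finset.sum_le_sum fun k _ => ?_)
      (h' n (2 * N) hn))
    exact mul_le_of_le_one_left (powLog_nonneg hK (Nat.cast_nonneg k)) (devCoef_le_one hs n N k)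

theorem powLog_one_le {γ K x y z : ℝ} (hγ : 0 ≤ γ) (hK : 1 < K) (hx : 0 ≤ x) (hxy : x ≤ y)
    (hz : 0 < z) (hzy : 1 / z ≤ y) : powLog 1 γ K y ≤ z * Real.log (x + K) ^ (-γ) := by
  have hz' : 0 < 1 / z := by positivity
  refine mul_le_mul ?_ (log_add_rpow_neg_anti hK hγ hx hxy)
    (Real.rpow_nonneg (log_add_pos hK (hx.trans hxy)).le _) hz.le
  rw [Real.rpow_neg_one, ← one_div, one_div_le (hz'.trans_le hzy) hz]
  exact hzy

/-- Now cos(ku - d) = sin(ku) sin d is at most ku in absolute value, which cancels the weight 1/k.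
For n ≤ k < 1/u each term is then at most u ln^(-γ)(n + K), and there are O(1/u) of them; beyond
that Abel summation applies. -/
theorem abs_devKernel_one_le_of_cos_eq_zero {γ K s : ℝ} (hK : 1 < K) (hγ : 0 < γ) (hs : 0 < s) :
    ∃ C : ℝ, 0 < C ∧ ∀ (n N : ℕ) (d u : ℝ), 1 ≤ n → n ≤ N → Real.cos d = 0 →
      |devKernel 1 γ K s n N d u| ≤ C * Real.log (n + K) ^ (-γ) := by
  obtain ⟨C, hC, h⟩ := abs_sum_devCoef_head_le (s := s) hK hγ hs
  have hpi := Real.pi_pos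
  refine ⟨C + (1 + Real.pi + Real.pi), by positivity, fun n N d u hn hnN hd => ?_⟩
  have hn' : (0 : ℝ) < n := by exact_mod_cast hn
  have hl := log_add_pos hK hn'.le
  have main : ∀ d u : ℝ, Real.cos d = 0 → 0 < u → u ≤ Real.pi →
      |devKernel 1 γ K s n N d u|
        ≤ (C + (1 + Real.pi + Real.pi)) * Real.log (n + K) ^ (-γ) := by
    intro d u hd hu hupi
    set M := max n ⌈1 / u⌉₊ with hM
    have hnM : n ≤ M := le_max_left _ _
    have hM1 : 1 / u ≤ M := (Nat.le_ceil _).trans (by exact_mod_cast le_max_right _ _)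
    have hMn : ((M - n : ℕ) : ℝ) * u ≤ 1 + Real.pi := by
      rcases le_total ⌈1 / u⌉₊ n with h1 | h1
      · rw [hM, max_eq_left h1]
        simp
        positivity
      · have h2 := (Nat.ceil_lt_add_one (by positivity : 0 ≤ 1 / u)).le
        have h3 : ((M - n : ℕ) : ℝ) ≤ 1 / u + 1 := by
          refine le_trans ?_ h2
          rw [hM, max_eq_right h1]
          exact_mod_cast Nat.sub_le _ _
        calc _ ≤ (1 / u + 1) * u := by gcongr
          _ = 1 + u := by field_simp
          _ ≤ _ := by linarith
    rw [devKernel_eq_sum (Q := 2 * N + M) (hn.trans hnN) hnN (by omega),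
      ← Finset.sum_Ico_consecutive _ hn (by omega : n ≤ 2 * N + M),
      ← Finset.sum_Ico_consecutive _ hnM (by omega : M ≤ 2 * N + M), add_mul, add_mul]
    refine (abs_add_le _ _).trans (add_le_add (h n N d u hn)
      ((abs_add_le _ _).trans (add_le_add ?_ ?_)))
    · calc _ ≤ ∑ k ∈ Finset.Ico n M, u * Real.log (n + K) ^ (-γ) := by
            refine (Finset.abs_sum_le_sum_abs _ _).trans (Finset.sum_le_sum fun k hk => ?_)
            have hnk : (n : ℝ) ≤ k := by exact_mod_cast (Finset.mem_Ico.1 hk).1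
            have hk0 : (0 : ℝ) < k := by linarith
            have hp := powLog_nonneg (a := 1) (γ := γ) hK hk0.le
            have hcos : |Real.cos (k * u - d)| ≤ k * u := by
              rw [Real.cos_sub, hd, mul_zero, zero_add, abs_mul]
              calc _ ≤ |Real.sin (k * u)| * 1 := by
                    gcongr
                    exact Real.abs_sin_le_one d
                _ ≤ |(k : ℝ) * u| := by rw [mul_one]; exact Real.abs_sin_le_abs
                _ = k * u := abs_of_pos (by positivity)
            have hpk : powLog 1 γ K k ≤ 1 / k * Real.log (n + K) ^ (-γ) :=
              powLog_one_le hγ.le hK hn'.le hnk (by positivity) (by simp)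
            rw [abs_mul, abs_mul, abs_of_nonneg (devCoef_nonneg _ _ _ _), abs_of_nonneg hp]
            calc _ ≤ 1 * (1 / k * Real.log (n + K) ^ (-γ)) * (k * u) := by
                  have := devCoef_le_one hs n N k
                  gcongr
              _ = _ := by field_simp
        _ = ((M - n : ℕ) : ℝ) * u * Real.log (n + K) ^ (-γ) := by
            rw [Finset.sum_const, Nat.card_Ico, nsmul_eq_mul, mul_assoc]
        _ ≤ _ := by gcongr
    · refine (abs_sum_devCoef_tail_le zero_le_one hγ.le hK (hn.trans hnM) hnM _ d hu hupi).trans ?_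
      have := powLog_one_le hγ.le hK hn'.le (by exact_mod_cast hnM : (n : ℝ) ≤ M) hu hM1
      calc _ ≤ u * Real.log (n + K) ^ (-γ) * (Real.pi / u) := by gcongr
        _ = _ := by field_simp
  -- Periodicity brings u into (-π, π], and reflection replaces d by -d, which preserves cos d = 0.
  -- At 0 the kernel vanishes.
  obtain ⟨y, hy, hyu⟩ := (devKernel_periodic 1 γ K s n N d).exists_mem_Ioc Real.two_pi_pos u
    (-Real.pi)
  rw [hyu]
  rcases lt_trichotomy y 0 with hy0 | rfl | hy0
  · rw [← neg_neg y, devKernel_neg]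
    exact main (-d) (-y) (by rwa [Real.cos_neg]) (by linarith) (by linarith [hy.1])
  · have : devKernel 1 γ K s n N d 0 = 0 := by simp [devKernel, hd]
    rw [this, abs_zero]
    positivity
  · exact main d y hd hy0 (by linarith [hy.2])

/-! ### Upper bounds for the deviations -/

theorem MemLper.intervalIntegrable {φ : ℝ → ℝ} (h : MemLper 1 φ) :
    IntervalIntegrable φ volume 0 (2 * Real.pi) := by
  rw [intervalIntegrable_iff_integrableOn_Ioc_of_le Real.two_pi_pos.le]
  exact memLp_one_iff_integrable.1 h.2

theorem IsPsiBetaDeriv.harm_eq {ψ : ℝ → ℝ} {β : ℝ} {f φ : ℝ → ℝ} (h : IsPsiBetaDeriv ψ β f φ)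
    {k : ℕ} (hk : 1 ≤ k) (hψ : ψ k ≠ 0) (x : ℝ) :
    harm f k x = (1 / Real.pi) * ∫ t in (0 : ℝ)..(2 * Real.pi),
      ψ k * (φ t * Real.cos (k * (x - t) - β * Real.pi / 2)) := by
  have hk0 : (k : ℝ) ≠ 0 := by positivity
  -- This shift, depending on k, moves the phase βπ/2 from f to φ.
  have h1 := h.2.2 k hk (x - (β * Real.pi / 2) / k)
  have e : (k : ℝ) * (x - (β * Real.pi / 2) / k) + β * Real.pi / 2 = k * x := by
    field_simp; ring
  change _ = harm φ k _ at h1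
  rw [e, harm_eq_integral h.1.intervalIntegrable, one_div_mul_eq_div, div_eq_iff hψ] at h1
  rw [harm, h1, intervalIntegral.integral_const_mul]
  have h2 : ∀ t : ℝ, (k : ℝ) * (x - (β * Real.pi / 2) / k - t)
      = k * (x - t) - β * Real.pi / 2 := by
    intro t; field_simp; ring
  simp_rw [h2]
  ring

theorem vpMean_sub_zygmundSum (s : ℝ) {n N : ℕ} (hn : 1 ≤ n) (hnN : n ≤ N) (f : ℝ → ℝ) (x : ℝ) :
    vpMean N f x - zygmundSum s n f x
      = ∑ k ∈ Finset.Ico 1 (2 * N), devCoef s n N k * harm f k x := by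
  have h1 : ∑ k ∈ Finset.Ico 1 n, devCoef s n N k * harm f k x
      = ∑ k ∈ Finset.Ico 1 n, vpCoef N k * harm f k x
        - ∑ k ∈ Finset.Ico 1 n, (1 - ((k : ℝ) / (n : ℝ)) ^ s) *
          (fourierA f k * Real.cos (k * x) + fourierB f k * Real.sin (k * x)) := by
    rw [← Finset.sum_sub_distrib]
    refine Finset.sum_congr rfl fun k hk => ?_
    have hk := (Finset.mem_Ico.1 hk).2
    rw [devCoef, if_pos hk, vpCoef_of_le (hn.trans hnN) (hk.le.trans hnN), harm]
    ring
  have h2 : ∑ k ∈ Finset.Ico n (2 * N), devCoef s n N k * harm f k x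
      = ∑ k ∈ Finset.Ico n (2 * N), vpCoef N k * harm f k x := by
    refine Finset.sum_congr rfl fun k hk => ?_
    have hk := (Finset.mem_Ico.1 hk).1
    rw [devCoef, if_neg (by omega)]
  rw [vpMean, zygmundSum, ← Finset.sum_Ico_consecutive _ hn (by omega : n ≤ 2 * N),
    ← Finset.sum_Ico_consecutive _ hn (by omega : n ≤ 2 * N), h1, h2]
  ring

theorem vpMean_sub_zygmundSum_eq_integral {p γ K β s : ℝ} (hK : 1 < K) {f φ : ℝ → ℝ}
    (h : IsPsiBetaDeriv (psiLog p γ K) β f φ) {n N : ℕ} (hn : 1 ≤ n) (hnN : n ≤ N) (x : ℝ) :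
    vpMean N f x - zygmundSum s n f x = (1 / Real.pi) * ∫ t in (0 : ℝ)..(2 * Real.pi),
      φ t * devKernel (1 / p) γ K s n N (β * Real.pi / 2) (x - t) := by
  have hφ := h.1.intervalIntegrable
  have h1 : ∀ t : ℝ, φ t * devKernel (1 / p) γ K s n N (β * Real.pi / 2) (x - t)
      = ∑ k ∈ Finset.Ico 1 (2 * N), devCoef s n N k * (psiLog p γ K k *
        (φ t * Real.cos (k * (x - t) - β * Real.pi / 2))) := by
    intro t
    rw [devKernel, Finset.mul_sum]
    refine Finset.sum_congr rfl fun k _ => ?_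
    rw [psiLog_eq_powLog]
    ring
  simp_rw [h1]
  rw [vpMean_sub_zygmundSum s hn hnN, intervalIntegral.integral_finsetSum, Finset.mul_sum]
  · refine Finset.sum_congr rfl fun k hk => ?_
    have hk := (Finset.mem_Ico.1 hk).1
    have hk0 : (0 : ℝ) < k := by exact_mod_cast hk
    rw [h.harm_eq hk (powLog_pos hK hk0).ne', intervalIntegral.integral_const_mul (devCoef s n N k)]
    ring
  · intro k _
    exact ((hφ.mul_continuousOn (Continuous.continuousOn (by fun_prop))).const_mul _).const_mul _

theorem zygmundDev_le {p γ K β s B : ℝ} (hK : 1 < K) {P : ℝ≥0∞} {n : ℕ} (hn : 1 ≤ n)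
    (h : ∀ φ : ℝ → ℝ, MemLper 1 φ → MemLper P φ → normLper P φ ≤ 1 → ∀ N, n ≤ N → ∀ x : ℝ,
      |∫ t in (0 : ℝ)..(2 * Real.pi),
        φ t * devKernel (1 / p) γ K s n N (β * Real.pi / 2) (x - t)| ≤ B) :
    zygmundDev s (classC (psiLog p γ K) β P) n ≤ ENNReal.ofReal B := by
  refine iSup₂_le fun f hf => iSup_le fun x => ENNReal.ofReal_le_ofReal ?_
  obtain ⟨hfc, hfp, φ, hφ, hφp, hφn⟩ := hf
  refine abs_sub_le_of_vpMean (n := n) hfc hfp fun N hnN hN => ?_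
  rw [vpMean_sub_zygmundSum_eq_integral hK hφ hn hnN, abs_mul, abs_of_pos (by positivity)]
  have h1 : 1 / Real.pi ≤ 1 := by
    rw [div_le_one Real.pi_pos]
    linarith [Real.pi_gt_three]
  exact (mul_le_of_le_one_left (abs_nonneg _) h1).trans (h φ hφ.1 hφp hφn N hnN x)

theorem abs_integral_mul_le_of_normLper_one {φ g : ℝ → ℝ} (hφ : MemLper 1 φ)
    (hn : normLper 1 φ ≤ 1) {B : ℝ} (hB : 0 ≤ B) (hg : Continuous g) (hgB : ∀ t, |g t| ≤ B) :
    |∫ t in (0 : ℝ)..(2 * Real.pi), φ t * g t| ≤ B := by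
  have hi := hφ.intervalIntegrable
  have h1 : ∫ t in (0 : ℝ)..(2 * Real.pi), |φ t| ≤ 1 := by
    rw [intervalIntegral.integral_of_le Real.two_pi_pos.le]
    have := hn
    rw [normLper, eLpNorm_one_eq_lintegral_enorm,
      ← ofReal_integral_norm_eq_lintegral_enorm (memLp_one_iff_integrable.1 hφ.2)] at this
    simpa using this
  calc _ ≤ ∫ t in (0 : ℝ)..(2 * Real.pi), |φ t * g t| :=
        intervalIntegral.abs_integral_le_integral_abs Real.two_pi_pos.le
    _ ≤ ∫ t in (0 : ℝ)..(2 * Real.pi), |φ t| * B := by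
        refine intervalIntegral.integral_mono_on Real.two_pi_pos.le
          (hi.mul_continuousOn hg.continuousOn).abs (hi.abs.mul_const _) fun t _ => ?_
        rw [abs_mul]
        exact mul_le_mul_of_nonneg_left (hgB t) (abs_nonneg _)
    _ ≤ B := by
        rw [intervalIntegral.integral_mul_const]
        exact mul_le_of_le_one_left hB h1

/-- The restriction n ≥ 2 keeps ln n away from 0. -/
theorem exists_log_add_le {K : ℝ} (hK : 1 < K) :
    ∃ A : ℝ, 0 < A ∧ ∀ n : ℕ, 2 ≤ n → Real.log (n + K) ≤ A * Real.log n := by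
  have h2 : 0 < Real.log 2 := Real.log_pos (by norm_num)
  have h1K : 0 < Real.log (1 + K) := Real.log_pos (by linarith)
  refine ⟨1 + Real.log (1 + K) / Real.log 2, by positivity, fun n hn => ?_⟩
  have hn' : (2 : ℝ) ≤ n := by exact_mod_cast hn
  have h3 : Real.log 2 ≤ Real.log n := Real.log_le_log (by norm_num) hn'
  have h4 : Real.log (n + K) ≤ Real.log n + Real.log (1 + K) := by
    rw [← Real.log_mul (by linarith) (by linarith)]
    exact Real.log_le_log (by linarith) (by nlinarith)
  have h5 : Real.log (1 + K) ≤ Real.log (1 + K) / Real.log 2 * Real.log n := by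
    calc _ = Real.log (1 + K) / Real.log 2 * Real.log 2 := by field_simp
      _ ≤ _ := by gcongr
  linarith

theorem psiLog_mul_rpow {p γ K x : ℝ} (hx : 0 < x) :
    psiLog p γ K x * x ^ (1 / p) = Real.log (x + K) ^ (-γ) := by
  rw [psiLog, Real.rpow_neg hx.le]
  have : x ^ (1 / p) ≠ 0 := (Real.rpow_pos_of_pos hx _).ne'
  field_simp

theorem bigOFrom_of_le {N : ℕ} {A : ℕ → ℝ≥0∞} {R : ℕ → ℝ} {C : ℝ} (hC : 0 < C)
    (h : ∀ n, N ≤ n → A n ≤ ENNReal.ofReal (C * R n)) :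
    BigOFrom N A fun n => ENNReal.ofReal (R n) :=
  ⟨C, hC, fun n hn => (h n hn).trans_eq (ENNReal.ofReal_mul hC.le)⟩

theorem zygmundDev_one_bigO {γ K s : ℝ} (β : ℝ) (hK : 1 < K) (hγ : 1 < γ) (hs : 0 < s) :
    BigOFrom 2 (zygmundDev s (classC (psiLog 1 γ K) β 1))
      fun n : ℕ => ENNReal.ofReal (psiLog 1 γ K n * n * Real.log n) := by
  obtain ⟨C, hC, h⟩ := abs_devKernel_one_le hK hγ hs
  obtain ⟨A, hA, hA'⟩ := exists_log_add_le hK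
  refine bigOFrom_of_le (mul_pos hC hA) fun n hn => ?_
  have hn' : (0 : ℝ) < n := by exact_mod_cast (by omega : 0 < n)
  have hl := log_add_pos hK hn'.le
  refine (zygmundDev_le (B := C * Real.log (n + K) ^ (1 - γ)) hK (by omega)
    fun φ hφ _ hφn N hnN x => ?_).trans (ENNReal.ofReal_le_ofReal ?_)
  · refine abs_integral_mul_le_of_normLper_one hφ hφn (by positivity)
      ((continuous_devKernel _ _ _ _ _ _ _).comp (by fun_prop)) fun t => ?_
    simpa using h n N (β * Real.pi / 2) (x - t) (by omega) hnN
  · have := psiLog_mul_rpow (p := 1) (γ := γ) (K := K) hn'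
    rw [div_one, Real.rpow_one] at this
    rw [this, sub_eq_add_neg, Real.rpow_add hl, Real.rpow_one]
    calc _ ≤ C * ((A * Real.log n) * Real.log (n + K) ^ (-γ)) := by
          have := hA' n hn
          gcongr
      _ = _ := by ring

theorem zygmundDev_one_bigO_of_cos_eq_zero {γ K s β : ℝ} (hK : 1 < K) (hγ : 1 < γ) (hs : 0 < s)
    (hβ : Real.cos (β * Real.pi / 2) = 0) :
    BigOFrom 1 (zygmundDev s (classC (psiLog 1 γ K) β 1))
      fun n : ℕ => ENNReal.ofReal (psiLog 1 γ K n * n) := by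
  obtain ⟨C, hC, h⟩ := abs_devKernel_one_le_of_cos_eq_zero hK (by linarith : 0 < γ) hs
  refine bigOFrom_of_le hC fun n hn => ?_
  have hn' : (0 : ℝ) < n := by exact_mod_cast (by omega : 0 < n)
  have hl := log_add_pos hK hn'.le
  have e := psiLog_mul_rpow (p := 1) (γ := γ) (K := K) hn'
  rw [div_one, Real.rpow_one] at e
  rw [e]
  refine zygmundDev_le hK (by omega) fun φ hφ _ hφn N hnN x => ?_
  refine abs_integral_mul_le_of_normLper_one hφ hφn (by positivity)
    ((continuous_devKernel _ _ _ _ _ _ _).comp (by fun_prop)) fun t => ?_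
  simpa using h n N (β * Real.pi / 2) (x - t) (by omega) hnN hβ

/-! ### Integrals of the kernels -/

/-- The denominator u(1 + Ku) is exactly what differentiating ln(1/u + K) produces, so ln^(1-g)(1/u
+ K)/(g-1) is an antiderivative. As g > 1 it extends continuously by 0 to u = 0. -/
theorem integral_inv_mul_log_rpow {K g b : ℝ} (hK : 1 < K) (hg : 1 < g) (hb : 0 < b) :
    IntervalIntegrable (fun u => Real.log (1 / u + K) ^ (-g) / (u * (1 + K * u))) volume 0 b ∧
    ∫ u in (0 : ℝ)..b, Real.log (1 / u + K) ^ (-g) / (u * (1 + K * u))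
      = Real.log (1 / b + K) ^ (1 - g) / (g - 1) := by
  set G : ℝ → ℝ := fun u => if u ≤ 0 then 0 else Real.log (1 / u + K) ^ (1 - g) / (g - 1) with hG
  have hg1 : 0 < g - 1 := by linarith
  have hGpos : ∀ u, 0 < u → G u = Real.log (1 / u + K) ^ (1 - g) / (g - 1) := fun u hu => by
    simp [hG, not_le.2 hu]
  have hlog : ∀ u : ℝ, 0 < u → 0 < Real.log (1 / u + K) := fun u hu =>
    log_add_pos hK (by positivity)
  have hd : ∀ u : ℝ, 0 < u →
      HasDerivAt G (Real.log (1 / u + K) ^ (-g) / (u * (1 + K * u))) u := by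
    intro u hu
    have h0 : 1 / u + K ≠ 0 := by positivity
    have h1 : HasDerivAt (fun u : ℝ => 1 / u + K) (-(u ^ 2)⁻¹) u := by
      simpa [one_div] using (hasDerivAt_inv hu.ne').add_const K
    have h2 := ((h1.log h0).rpow_const (p := 1 - g) (Or.inl (hlog u hu).ne')).div_const (g - 1)
    have h3 := h2.congr_of_eventuallyEq (f₁ := G)
      (Filter.eventually_of_mem (Ioi_mem_nhds hu) fun v hv => hGpos v hv)
    refine h3.congr_deriv ?_
    rw [show 1 - g - 1 = -g by ring]
    have : 0 < 1 + K * u := by positivity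
    field_simp
    ring
  have hcont : ContinuousOn G (Icc 0 b) := by
    intro u hu
    rcases hu.1.eq_or_lt with rfl | h
    · have hG0 : G 0 = 0 := by simp [hG]
      rw [ContinuousWithinAt, hG0]
      have ht : Filter.Tendsto (fun u : ℝ => Real.log (1 / u + K) ^ (1 - g) / (g - 1))
          (nhdsWithin 0 (Ioi 0)) (nhds 0) := by
        have h1 : Filter.Tendsto (fun u : ℝ => 1 / u + K) (nhdsWithin 0 (Ioi 0)) Filter.atTop := by
          simpa [one_div] using Filter.tendsto_atTop_add_const_right _ K tendsto_inv_nhdsGT_zero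
        have h2 := (tendsto_rpow_neg_atTop hg1).comp (Real.tendsto_log_atTop.comp h1)
        have h3 := h2.div_const (g - 1)
        rw [zero_div] at h3
        refine h3.congr fun u => ?_
        simp
      have ht2 : Filter.Tendsto G (nhdsWithin 0 (Ioi 0)) (nhds 0) :=
        ht.congr' (Filter.eventually_of_mem self_mem_nhdsWithin fun v hv => (hGpos v hv).symm)
      have ht3 : Filter.Tendsto G (nhdsWithin 0 (Ici 0)) (nhds 0) := by
        rw [← Ioi_insert, nhdsWithin_insert]
        refine Filter.Tendsto.sup ?_ ht2
        rw [Filter.tendsto_pure_left]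
        intro s hs
        rw [hG0]
        exact mem_of_mem_nhds hs
      exact ht3.mono_left (nhdsWithin_mono _ Icc_subset_Ici_self)
    · exact (hd u h).continuousAt.continuousWithinAt
  have hint : IntervalIntegrable (fun u => Real.log (1 / u + K) ^ (-g) / (u * (1 + K * u)))
      volume 0 b := by
    rw [intervalIntegrable_iff_integrableOn_Ioc_of_le hb.le]
    refine intervalIntegral.integrableOn_deriv_of_nonneg hcont (fun u hu => hd u hu.1)
      fun u hu => ?_
    have hu0 := hu.1
    have := hlog u hu0
    positivity
  refine ⟨hint, ?_⟩
  rw [intervalIntegral.integral_eq_sub_of_hasDerivAt_of_le hb.le hcont (fun u hu => hd u hu.1) hint,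
    hGpos b hb]
  simp [hG]

/-- The q-th power of u^(-1/q) is 1/u, the source of the logarithm. Used for the deviation kernels
and, with e = 1, for the test polynomials. -/
theorem integral_abs_rpow_le {D : ℝ → ℝ} (hD : Continuous D) {C q b e : ℝ} (hC : 0 < C) (hq : 1 < q)
    (hb : 0 < b) (hb1 : b ≤ 1) (he : 0 ≤ e)
    (hlarge : ∀ u, b ≤ u → u ≤ Real.pi → |D u| ≤ C * (u ^ (-(1 / q)) * e)) :
    ∫ u in b..Real.pi, |D u| ^ q ≤ C ^ q * e ^ q * Real.log (Real.pi / b) := by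
  have hbpi : b ≤ Real.pi := by linarith [Real.pi_gt_three]
  have hq0 : 0 < q := by linarith
  have hi : IntervalIntegrable (fun u : ℝ => u⁻¹) volume b Real.pi := by
    refine intervalIntegral.intervalIntegrable_inv (fun u hu => ?_) continuousOn_id
    rw [uIcc_of_le hbpi] at hu
    exact (hb.trans_le hu.1).ne'
  calc _ ≤ ∫ u in b..Real.pi, C ^ q * e ^ q * u⁻¹ := by
        refine intervalIntegral.integral_mono_on hbpi
          (Continuous.intervalIntegrable (hD.abs.rpow_const fun _ => Or.inr hq0.le) _ _)
          (hi.const_mul _) fun u hu => ?_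
        have hu0 : 0 < u := hb.trans_le hu.1
        refine (Real.rpow_le_rpow (abs_nonneg _) (hlarge u hu.1 hu.2) hq0.le).trans_eq ?_
        rw [Real.mul_rpow hC.le (by positivity), Real.mul_rpow (by positivity) he,
          ← Real.rpow_mul hu0.le]
        have : -(1 / q) * q = -1 := by field_simp
        rw [this, Real.rpow_neg_one]
        ring
    _ = _ := by
        rw [intervalIntegral.integral_const_mul, integral_inv_of_pos hb Real.pi_pos]

theorem integral_abs_devKernel_rpow_le {a γ K s q : ℝ} (ha : 0 ≤ a) (haq : 1 - a = 1 / q)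
    (hq : 1 < q) (hK : 1 < K) (hγ : 1 < γ * q) (hs : 0 < s) :
    ∃ C : ℝ, 0 < C ∧ ∀ (n N : ℕ) (d : ℝ), 2 ≤ n → n ≤ N →
      ∫ u in (0 : ℝ)..Real.pi, |devKernel a γ K s n N d u| ^ q
        ≤ C * (Real.log (n + K) ^ (-(γ * q)) * Real.log n) := by
  have hq0 : 0 < q := by linarith
  have hγ0 : 0 < γ := pos_of_mul_pos_left (by linarith) hq0.le
  have ha1 : a < 1 := by
    have : 0 < 1 / q := by positivity
    linarith
  have haq' : a - 1 = -(1 / q) := by linarith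
  obtain ⟨C₁, hC₁, h₁⟩ := abs_devKernel_le_of_small ha ha1 hK hγ0
  obtain ⟨C₂, hC₂, h₂⟩ := abs_devKernel_le_of_large ha ha1 hK hγ0 hs
  obtain ⟨A, hA, hA'⟩ := exists_log_add_le hK
  have hγq : 0 < γ * q - 1 := by linarith
  have hlog2 : 0 < Real.log 2 := Real.log_pos (by norm_num)
  have hlogpi : 0 < Real.log Real.pi := Real.log_pos (by linarith [Real.pi_gt_three])
  refine ⟨C₁ ^ q * (1 + K) / (γ * q - 1) * A + C₂ ^ q * (Real.log Real.pi / Real.log 2 + 1),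
    by positivity, fun n N d hn hnN => ?_⟩
  have hn' : (2 : ℝ) ≤ n := by exact_mod_cast hn
  have hn0 : (0 : ℝ) < n := by linarith
  set b : ℝ := 1 / n with hbdef
  have hb : 0 < b := by positivity
  have hb1 : b ≤ 1 := by rw [hbdef, div_le_one hn0]; linarith
  have hbinv : 1 / b = n := by rw [hbdef, one_div_one_div]
  have hl := log_add_pos hK hn0.le
  have hln : Real.log 2 ≤ Real.log n := Real.log_le_log (by norm_num) hn'
  have hDc := continuous_devKernel a γ K s n N d
  have hDq : Continuous fun u => |devKernel a γ K s n N d u| ^ q :=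
    hDc.abs.rpow_const fun _ => Or.inr hq0.le
  obtain ⟨hGi, hG⟩ := integral_inv_mul_log_rpow hK hγ hb
  have hsmall : ∫ u in (0 : ℝ)..b, |devKernel a γ K s n N d u| ^ q
      ≤ C₁ ^ q * (1 + K) / (γ * q - 1) * A * (Real.log (n + K) ^ (-(γ * q)) * Real.log n) := by
    calc _ ≤ ∫ u in (0 : ℝ)..b, C₁ ^ q * (1 + K)
            * (Real.log (1 / u + K) ^ (-(γ * q)) / (u * (1 + K * u))) := by
          refine intervalIntegral.integral_mono_on_of_le_Ioo hb.le (hDq.intervalIntegrable _ _)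
            (hGi.const_mul _) fun u hu => ?_
          have hu0 := hu.1
          have hlu := log_add_pos hK (by positivity : 0 ≤ 1 / u)
          refine (Real.rpow_le_rpow (abs_nonneg _)
            (h₁ s n N d u hs (by omega) hnN hu0 hu.2.le) hq0.le).trans ?_
          rw [Real.mul_rpow hC₁.le (by positivity), Real.mul_rpow (by positivity) (by positivity),
            ← Real.rpow_mul hu0.le, ← Real.rpow_mul hlu.le, haq']
          have e1 : -(1 / q) * q = -1 := by field_simp
          rw [e1, Real.rpow_neg_one, neg_mul, mul_assoc]
          -- Passage to the exactly integrable form, valid since u ≤ 1.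
          have h3 : u⁻¹ ≤ (1 + K) / (u * (1 + K * u)) := by
            rw [inv_eq_one_div, div_le_div_iff₀ hu0 (by positivity)]
            have hu1 : u ≤ 1 := hu.2.le.trans hb1
            nlinarith [mul_nonneg hu0.le (sub_nonneg.2 hu1)]
          calc _ ≤ C₁ ^ q * ((1 + K) / (u * (1 + K * u)) * Real.log (1 / u + K) ^ (-(γ * q))) := by
                gcongr
            _ = _ := by ring
      _ = C₁ ^ q * (1 + K) / (γ * q - 1) * (Real.log (n + K) ^ (-(γ * q)) * Real.log (n + K)) := by
          rw [intervalIntegral.integral_const_mul, hG, hbinv, sub_eq_add_neg, Real.rpow_add hl,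
            Real.rpow_one]
          ring
      _ ≤ C₁ ^ q * (1 + K) / (γ * q - 1) * (Real.log (n + K) ^ (-(γ * q)) * (A * Real.log n)) := by
          have := hA' n hn
          gcongr
      _ = _ := by ring
  have hlarge : ∫ u in b..Real.pi, |devKernel a γ K s n N d u| ^ q
      ≤ C₂ ^ q * (Real.log Real.pi / Real.log 2 + 1)
        * (Real.log (n + K) ^ (-(γ * q)) * Real.log n) := by
    refine (integral_abs_rpow_le hDc hC₂ hq hb hb1 (e := Real.log (n + K) ^ (-γ)) (by positivity)
      fun u hu1 hu2 => ?_).trans ?_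
    · rw [← haq']
      exact h₂ n N d u (by omega) hnN hu1 hu2
    · have h4 : Real.log (Real.pi / b) ≤ (Real.log Real.pi / Real.log 2 + 1) * Real.log n := by
        have h5 : Real.log Real.pi ≤ Real.log Real.pi / Real.log 2 * Real.log n := by
          calc _ = Real.log Real.pi / Real.log 2 * Real.log 2 := by field_simp
            _ ≤ _ := by gcongr
        rw [div_eq_mul_one_div, hbinv, Real.log_mul Real.pi_ne_zero hn0.ne']
        linarith
      rw [← Real.rpow_mul hl.le, neg_mul]
      calc _ ≤ C₂ ^ q * Real.log (n + K) ^ (-(γ * q))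
            * ((Real.log Real.pi / Real.log 2 + 1) * Real.log n) := by gcongr
        _ = _ := by ring
  rw [← intervalIntegral.integral_add_adjacent_intervals (hDq.intervalIntegrable 0 b)
    (hDq.intervalIntegrable b Real.pi), add_mul]
  exact add_le_add hsmall hlarge

theorem integral_abs_rpow_comp_sub {D : ℝ → ℝ} (hD : Continuous D)
    (hp : Function.Periodic D (2 * Real.pi)) {q : ℝ} (hq : 0 ≤ q) (x : ℝ) :
    ∫ t in (0 : ℝ)..(2 * Real.pi), |D (x - t)| ^ q
      = (∫ u in (0 : ℝ)..Real.pi, |D (-u)| ^ q) + ∫ u in (0 : ℝ)..Real.pi, |D u| ^ q := by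
  have hDq : Continuous fun u => |D u| ^ q := hD.abs.rpow_const fun _ => Or.inr hq
  have hper : Function.Periodic (fun u => |D u| ^ q) (2 * Real.pi) :=
    fun u => by simp only [hp u]
  rw [intervalIntegral.integral_comp_sub_left (fun u => |D u| ^ q) x]
  have h1 := hper.intervalIntegral_add_eq (x - 2 * Real.pi) (-Real.pi)
  rw [sub_add_cancel, show -Real.pi + 2 * Real.pi = Real.pi by ring] at h1
  rw [sub_zero, h1, ← intervalIntegral.integral_add_adjacent_intervals
    (hDq.intervalIntegrable (-Real.pi) 0) (hDq.intervalIntegrable 0 Real.pi)]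
  congr 1
  have h2 := intervalIntegral.integral_comp_neg (a := 0) (b := Real.pi) (fun u => |D u| ^ q)
  rw [neg_zero] at h2
  exact h2.symm

theorem abs_integral_mul_le_of_normLper {p q : ℝ} (hpq : p.HolderConjugate q) {φ g : ℝ → ℝ}
    (hφ : MemLper (ENNReal.ofReal p) φ) (hn : normLper (ENNReal.ofReal p) φ ≤ 1)
    (hg : Continuous g) :
    |∫ t in (0 : ℝ)..(2 * Real.pi), φ t * g t|
      ≤ (∫ t in (0 : ℝ)..(2 * Real.pi), |g t| ^ q) ^ (1 / q) := by
  have hp0 := hpq.pos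
  have hgL : MemLp g (ENNReal.ofReal q) (volume.restrict (Ioc 0 (2 * Real.pi))) := by
    obtain ⟨B, hB⟩ := (isCompact_Icc (a := (0 : ℝ)) (b := 2 * Real.pi)).exists_bound_of_continuousOn
      hg.continuousOn
    refine MemLp.of_bound hg.aestronglyMeasurable B ?_
    filter_upwards [ae_restrict_mem measurableSet_Ioc] with t ht
    exact hB t (Ioc_subset_Icc_self ht)
  have h1 : (∫ t in Ioc 0 (2 * Real.pi), ‖φ t‖ ^ p) ^ (1 / p) ≤ 1 := by
    have h2 := hn
    rw [normLper, hφ.2.eLpNorm_eq_integral_rpow_norm (by simpa using hp0) ENNReal.ofReal_ne_top,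
      ENNReal.toReal_ofReal hp0.le] at h2
    rw [one_div]
    simpa using h2
  have h3 := integral_mul_norm_le_Lp_mul_Lq hpq hφ.2 hgL
  rw [intervalIntegral.integral_of_le Real.two_pi_pos.le,
    intervalIntegral.integral_of_le Real.two_pi_pos.le]
  calc _ ≤ ∫ t in Ioc 0 (2 * Real.pi), ‖φ t * g t‖ := norm_integral_le_integral_norm _
    _ = ∫ t in Ioc 0 (2 * Real.pi), ‖φ t‖ * ‖g t‖ := by simp_rw [norm_mul]
    _ ≤ _ := h3
    _ ≤ 1 * (∫ t in Ioc 0 (2 * Real.pi), ‖g t‖ ^ q) ^ (1 / q) := by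
        gcongr
    _ = _ := by rw [one_mul]; rfl

theorem zygmundDev_bigO {p q γ K s : ℝ} (β : ℝ) (hpq : p.HolderConjugate q) (hK : 1 < K)
    (hγ : 1 < γ * q) (hs : 0 < s) :
    BigOFrom 2 (zygmundDev s (classC (psiLog p γ K) β (ENNReal.ofReal p)))
      fun n : ℕ => ENNReal.ofReal (psiLog p γ K n * (n : ℝ) ^ (1 / p) * Real.log n ^ (1 / q)) := by
  have hp0 := hpq.pos
  have hq0 := hpq.symm.pos
  have haq : 1 - 1 / p = 1 / q := by
    have := hpq.inv_add_inv_eq_one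
    rw [one_div, one_div]
    linarith
  obtain ⟨C, hC, h⟩ := integral_abs_devKernel_rpow_le (a := 1 / p) (by positivity) haq
    hpq.symm.lt hK hγ hs
  refine bigOFrom_of_le (C := (2 * C) ^ (1 / q)) (by positivity) fun n hn => ?_
  have hn' : (0 : ℝ) < n := by exact_mod_cast (by omega : 0 < n)
  have hl := log_add_pos hK hn'.le
  have hln : 0 ≤ Real.log n := Real.log_natCast_nonneg n
  rw [psiLog_mul_rpow hn']
  refine zygmundDev_le hK (by omega) fun φ _ hφ hφn N hnN x => ?_
  refine (abs_integral_mul_le_of_normLper hpq hφ hφn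
    ((continuous_devKernel _ _ _ _ _ _ _).comp (by fun_prop))).trans ?_
  simp only [Function.comp_apply]
  rw [integral_abs_rpow_comp_sub (continuous_devKernel _ _ _ _ _ _ _)
    (devKernel_periodic _ _ _ _ _ _ _) hq0.le]
  -- The negative half-period becomes the positive one with opposite phase; the two halves account
  -- for the constant 2C.
  simp_rw [devKernel_neg]
  have h1 := h n N (-(β * Real.pi / 2)) hn hnN
  have h2 := h n N (β * Real.pi / 2) hn hnN
  have h3 : ∀ d, 0 ≤ ∫ u in (0 : ℝ)..Real.pi, |devKernel (1 / p) γ K s n N d u| ^ q := fun d =>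
    intervalIntegral.integral_nonneg Real.pi_pos.le fun u _ => by positivity
  refine (Real.rpow_le_rpow (add_nonneg (h3 _) (h3 _))
    ((add_le_add h1 h2).trans_eq (by ring :
      _ = 2 * C * (Real.log (n + K) ^ (-(γ * q)) * Real.log n))) (by positivity)).trans_eq ?_
  rw [Real.mul_rpow (by positivity) (by positivity), Real.mul_rpow (by positivity) hln,
    ← Real.rpow_mul hl.le]
  congr 3
  field_simp

/-! ### Lower bounds for the best approximations -/

/-- The trigonometric polynomial with amplitudes `l k` and common phase `c`. -/
def cosSum (l : ℕ → ℝ) (c : ℝ) (N : ℕ) (x : ℝ) : ℝ :=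
  ∑ k ∈ Finset.Ico 1 N, l k * Real.cos (k * x - c)

theorem continuous_cosSum (l : ℕ → ℝ) (c : ℝ) (N : ℕ) : Continuous (cosSum l c N) := by
  unfold cosSum
  fun_prop

theorem cosSum_periodic (l : ℕ → ℝ) (c : ℝ) (N : ℕ) :
    Function.Periodic (cosSum l c N) (2 * Real.pi) := by
  intro u
  refine Finset.sum_congr rfl fun k _ => ?_
  rw [show (k : ℝ) * (u + 2 * Real.pi) - c = k * u - c + k * (2 * Real.pi) by ring,
    Real.cos_add_nat_mul_two_pi]

theorem cosSum_neg (l : ℕ → ℝ) (c : ℝ) (N : ℕ) (u : ℝ) :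
    cosSum l c N (-u) = cosSum l (-c) N u := by
  refine Finset.sum_congr rfl fun k _ => ?_
  rw [← Real.cos_neg]
  congr 2
  ring

theorem cosSum_eq_trig (l : ℕ → ℝ) (c : ℝ) (N : ℕ) (t : ℝ) :
    cosSum l c N t = 0 + ∑ k ∈ Finset.Ico 1 N,
      ((l k * Real.cos c) * Real.cos (k * t) + (l k * Real.sin c) * Real.sin (k * t)) := by
  rw [zero_add]
  refine Finset.sum_congr rfl fun k _ => ?_
  rw [Real.cos_sub]
  ring

theorem harm_cosSum (l : ℕ → ℝ) (c : ℝ) (N k : ℕ) (hk : 1 ≤ k) (x : ℝ) :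
    harm (cosSum l c N) k x = if k < N then l k * Real.cos (k * x - c) else 0 := by
  rw [harm_trigPoly (cosSum_eq_trig l c N) k hk x, Real.cos_sub]
  split_ifs
  · ring
  · rfl

theorem fourierA_zero_cosSum (l : ℕ → ℝ) (c : ℝ) (N : ℕ) : fourierA (cosSum l c N) 0 = 0 := by
  rw [fourierA_zero_trigPoly (cosSum_eq_trig l c N), mul_zero]

theorem memLper_cosSum (l : ℕ → ℝ) (c : ℝ) (N : ℕ) (P : ℝ≥0∞) : MemLper P (cosSum l c N) := by
  refine ⟨cosSum_periodic l c N, MemLp.of_bound (continuous_cosSum l c N).aestronglyMeasurable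
    (∑ k ∈ Finset.Ico 1 N, |l k|) (Filter.Eventually.of_forall fun t => ?_)⟩
  refine (Finset.abs_sum_le_sum_abs _ _).trans (Finset.sum_le_sum fun k _ => ?_)
  rw [abs_mul]
  exact mul_le_of_le_one_right (abs_nonneg _) (Real.abs_cos_le_one _)

theorem isPsiBetaDeriv_cosSum {ψ : ℝ → ℝ} (hψ : ∀ k : ℕ, 1 ≤ k → ψ k ≠ 0) (β : ℝ) (l : ℕ → ℝ)
    (c : ℝ) (N : ℕ) :
    IsPsiBetaDeriv ψ β (cosSum (fun k => ψ k * l k) (c + β * Real.pi / 2) N) (cosSum l c N) := by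
  refine ⟨memLper_cosSum l c N 1, fourierA_zero_cosSum l c N, fun k hk x => ?_⟩
  have hk0 : (k : ℝ) ≠ 0 := by positivity
  have e : (k : ℝ) * x + β * Real.pi / 2 = k * (x + (β * Real.pi / 2) / k) := by
    field_simp
  change _ = harm _ k x
  rw [e]
  change 1 / ψ k * harm _ k _ = _
  rw [harm_cosSum _ _ _ _ hk, harm_cosSum _ _ _ _ hk, ← e, add_sub_add_right_eq_sub]
  have := hψ k hk
  split_ifs
  · field_simp
  · simp

theorem cosSum_sub_vpMean (l : ℕ → ℝ) (c : ℝ) (N : ℕ) {n : ℕ} (hn : 1 ≤ n) (x : ℝ) :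
    cosSum l c N x - vpMean n (cosSum l c N) x
      = ∑ k ∈ Finset.Ico 1 N, (1 - vpCoef n k) * (l k * Real.cos (k * x - c)) := by
  have h1 : ∑ k ∈ Finset.Ico 1 (2 * n), vpCoef n k * harm (cosSum l c N) k x
      = ∑ k ∈ Finset.Ico 1 (2 * n + N), vpCoef n k * harm (cosSum l c N) k x := by
    refine Finset.sum_subset (Finset.Ico_subset_Ico_right (by omega)) fun k hk hk' => ?_
    rw [vpCoef_eq_zero hn, zero_mul]
    by_contra h
    exact hk' (Finset.mem_Ico.2 ⟨(Finset.mem_Ico.1 hk).1, by omega⟩)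
  have h2 : ∑ k ∈ Finset.Ico 1 N, vpCoef n k * harm (cosSum l c N) k x
      = ∑ k ∈ Finset.Ico 1 (2 * n + N), vpCoef n k * harm (cosSum l c N) k x := by
    refine Finset.sum_subset (Finset.Ico_subset_Ico_right (by omega)) fun k hk hk' => ?_
    have hk := Finset.mem_Ico.1 hk
    rw [harm_cosSum _ _ _ _ hk.1, if_neg, mul_zero]
    exact fun h => hk' (Finset.mem_Ico.2 ⟨hk.1, h⟩)
  rw [vpMean, fourierA_zero_cosSum, h1, ← h2, zero_div, zero_add, cosSum,
    ← Finset.sum_sub_distrib]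
  refine Finset.sum_congr rfl fun k hk => ?_
  have hk := Finset.mem_Ico.1 hk
  have := harm_cosSum l c N k hk.1 x
  rw [if_pos hk.2] at this
  rw [this]
  ring

/-- Every polynomial of this form in the unit ball of L_P is a (ψ, β)-derivative of an explicit
member of the class, so lower bounds reduce to choosing l, c and x. -/
theorem ofReal_abs_sum_le_bestApprox {p γ K β : ℝ} (hK : 1 < K) {P : ℝ≥0∞} {l : ℕ → ℝ} {c : ℝ}
    {N n : ℕ} (hn : 1 ≤ n) (hl : normLper P (cosSum l c N) ≤ 1) (x : ℝ) :
    ENNReal.ofReal (|∑ k ∈ Finset.Ico 1 N, (1 - vpCoef n k) *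
      (psiLog p γ K k * l k * Real.cos (k * x - (c + β * Real.pi / 2)))| / 4)
      ≤ bestApprox (classC (psiLog p γ K) β P) n := by
  have hmem : cosSum (fun k => psiLog p γ K k * l k) (c + β * Real.pi / 2) N
      ∈ classC (psiLog p γ K) β P := by
    refine ⟨continuous_cosSum _ _ _, cosSum_periodic _ _ _, cosSum l c N,
      isPsiBetaDeriv_cosSum (fun k hk => ?_) β l c N, memLper_cosSum l c N P, hl⟩
    exact (powLog_pos hK (by exact_mod_cast hk)).ne'
  have := ofReal_abs_sub_vpMean_le_bestApprox hmem (continuous_cosSum _ _ _) hn x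
  rwa [cosSum_sub_vpMean _ _ _ hn] at this

/-- Up to 4n² the logarithm grows at most fourfold, because 4n² + K ≤ (n + K)^4. -/
theorem log_rpow_neg_ge {K γ x : ℝ} (hK : 1 < K) (hγ : 0 ≤ γ) {n : ℕ} (hn : 1 ≤ n) (hx : 0 ≤ x)
    (hxn : x ≤ 4 * (n : ℝ) ^ 2) :
    (4 : ℝ) ^ (-γ) * Real.log (n + K) ^ (-γ) ≤ Real.log (x + K) ^ (-γ) := by
  have hn' : (1 : ℝ) ≤ n := by exact_mod_cast hn
  have hl := log_add_pos hK (by linarith : (0 : ℝ) ≤ n)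
  rw [← Real.mul_rpow (by norm_num) hl.le]
  refine Real.rpow_le_rpow_of_nonpos (log_add_pos hK hx) ?_ (by linarith)
  have h1 : (4 : ℝ) * Real.log (n + K) = Real.log ((n + K) ^ 4) := by
    rw [Real.log_pow]
    norm_num
  rw [h1]
  refine Real.log_le_log (by linarith) ?_
  have h2 : (4 : ℝ) ≤ (n + K) ^ 2 := by nlinarith
  have h3 : 4 * (n : ℝ) ^ 2 + K ≤ 4 * (n + K) ^ 2 := by nlinarith
  calc _ ≤ 4 * ((n : ℝ) + K) ^ 2 := by linarith
    _ ≤ (n + K) ^ 2 * (n + K) ^ 2 := by gcongr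
    _ = _ := by ring

theorem log_sub_log_le_sum_inv {A B : ℕ} (hA : 1 ≤ A) (hAB : A ≤ B) :
    Real.log B - Real.log A ≤ ∑ k ∈ Finset.Ico A B, (k : ℝ)⁻¹ := by
  rw [← Finset.sum_Ico_sub (fun k : ℕ => Real.log k) hAB]
  refine Finset.sum_le_sum fun k hk => ?_
  have hk0 : (0 : ℝ) < k := by exact_mod_cast hA.trans (Finset.mem_Ico.1 hk).1
  have h1 := Real.log_le_sub_one_of_pos (by positivity : 0 < ((k : ℝ) + 1) / k)
  rw [Real.log_div (by positivity) hk0.ne'] at h1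
  have h2 : ((k : ℝ) + 1) / k - 1 = (k : ℝ)⁻¹ := by field_simp; ring
  push_cast
  linarith

/-- The harmonics of order in `[2 n, 4 n ^ 2)` alone contribute a full logarithm. -/
theorem log_le_sum_vpCoef {K γ r : ℝ} (hK : 1 < K) (hγ : 0 ≤ γ) (hr : 0 ≤ r) {n N : ℕ} (hn : 1 ≤ n)
    (hN : 4 * n ^ 2 ≤ N) {w : ℕ → ℝ} (hw : ∀ k, 1 ≤ k → k < N → 0 ≤ w k)
    (hw' : ∀ k, 2 * n ≤ k → k < 4 * n ^ 2 →
      r * ((k : ℝ)⁻¹ * Real.log (k + K) ^ (-γ)) ≤ w k) :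
    r * ((4 : ℝ) ^ (-γ) * Real.log (n + K) ^ (-γ) * Real.log n)
      ≤ ∑ k ∈ Finset.Ico 1 N, (1 - vpCoef n k) * w k := by
  have hn' : (1 : ℝ) ≤ n := by exact_mod_cast hn
  have hl := log_add_pos hK (by linarith : (0 : ℝ) ≤ n)
  have h2n : 2 * n ≤ 4 * n ^ 2 := by nlinarith
  have hlog : Real.log n ≤ ∑ k ∈ Finset.Ico (2 * n) (4 * n ^ 2), (k : ℝ)⁻¹ := by
    refine le_trans ?_ (log_sub_log_le_sum_inv (by omega) h2n)
    rw [← Real.log_div (by positivity) (by positivity)]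
    refine Real.log_le_log (by linarith) ?_
    push_cast
    rw [le_div_iff₀ (by positivity)]
    nlinarith
  calc _ ≤ r * ((4 : ℝ) ^ (-γ) * Real.log (n + K) ^ (-γ)
          * ∑ k ∈ Finset.Ico (2 * n) (4 * n ^ 2), (k : ℝ)⁻¹) := by gcongr
    _ = ∑ k ∈ Finset.Ico (2 * n) (4 * n ^ 2),
          r * ((k : ℝ)⁻¹ * ((4 : ℝ) ^ (-γ) * Real.log (n + K) ^ (-γ))) := by
        rw [Finset.mul_sum, Finset.mul_sum]
        exact Finset.sum_congr rfl fun k _ => by ring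
    _ ≤ ∑ k ∈ Finset.Ico (2 * n) (4 * n ^ 2), (1 - vpCoef n k) * w k := by
        refine Finset.sum_le_sum fun k hk => ?_
        have hk := Finset.mem_Ico.1 hk
        rw [vpCoef_eq_zero hn hk.1, sub_zero, one_mul]
        refine le_trans ?_ (hw' k hk.1 hk.2)
        have := log_rpow_neg_ge (γ := γ) hK hγ hn (Nat.cast_nonneg k)
          (by exact_mod_cast hk.2.le)
        gcongr
    _ ≤ _ := by
        refine Finset.sum_le_sum_of_subset_of_nonneg ?_ fun k hk _ => ?_
        · exact Finset.Ico_subset_Ico (by omega) hN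
        · have hk := Finset.mem_Ico.1 hk
          exact mul_nonneg (sub_nonneg.2 (vpCoef_le_one n k)) (hw k hk.1 hk.2)

theorem bigOFrom_of_ge {N : ℕ} {A : ℕ → ℝ≥0∞} {R : ℕ → ℝ} {c : ℝ} (hc : 0 < c)
    (h : ∀ n, N ≤ n → ENNReal.ofReal (c * R n) ≤ A n) :
    BigOFrom N (fun n => ENNReal.ofReal (R n)) A := by
  refine ⟨c⁻¹, inv_pos.2 hc, fun n hn => ?_⟩
  calc ENNReal.ofReal (R n) = ENNReal.ofReal c⁻¹ * ENNReal.ofReal (c * R n) := by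
        rw [← ENNReal.ofReal_mul (inv_pos.2 hc).le, inv_mul_cancel_left₀ hc.ne']
    _ ≤ _ := by gcongr; exact h n hn

/-! #### The case `p = 1` -/

/-- The polynomial is (F_N - 1)/(4π), without free term as a derivative must be, and |F_N - 1| ≤ F_N
+ 1 has integral 4π. -/
theorem normLper_one_fejer_le (N : ℕ) :
    normLper 1 (cosSum (fun k => 1 / (2 * Real.pi) * (1 - (k : ℝ) / N)) 0 N) ≤ 1 := by
  have hpi := Real.pi_pos
  have h0 : ∀ t, cosSum (fun k => 1 / (2 * Real.pi) * (1 - (k : ℝ) / N)) 0 N t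
      = 1 / (4 * Real.pi) * (fejer N (0 - t) - 1) := by
    intro t
    rw [cosSum, fejer, add_sub_cancel_left, Finset.mul_sum, Finset.mul_sum]
    refine Finset.sum_congr rfl fun k _ => ?_
    rw [sub_zero, zero_sub, mul_neg, Real.cos_neg]
    field_simp
    ring
  have hF : Continuous fun t => fejer N (0 - t) := (continuous_fejer N).comp (by fun_prop)
  rw [normLper, eLpNorm_one_eq_lintegral_enorm, ← ofReal_integral_norm_eq_lintegral_enorm
    (memLp_one_iff_integrable.1 (memLper_cosSum _ _ _ 1).2), ENNReal.ofReal_le_one,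
    ← intervalIntegral.integral_of_le Real.two_pi_pos.le]
  calc _ ≤ ∫ t in (0 : ℝ)..(2 * Real.pi), 1 / (4 * Real.pi) * (fejer N (0 - t) + 1) := by
        refine intervalIntegral.integral_mono_on Real.two_pi_pos.le
          ((continuous_cosSum _ _ _).norm.intervalIntegrable _ _)
          (Continuous.intervalIntegrable (by fun_prop) _ _) fun t _ => ?_
        rw [h0, norm_mul, Real.norm_of_nonneg (by positivity)]
        refine mul_le_mul_of_nonneg_left ?_ (by positivity)
        have := fejer_nonneg N (0 - t)
        rw [Real.norm_eq_abs, abs_le]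
        constructor <;> linarith
    _ = 1 := by
        rw [intervalIntegral.integral_const_mul, intervalIntegral.integral_add
          (hF.intervalIntegrable _ _) (by simp), integral_fejer_sub]
        simp
        field_simp
        norm_num

theorem one_bigO_bestApprox {γ K β : ℝ} (hK : 1 < K) (hγ : 1 < γ)
    (hβ : Real.cos (β * Real.pi / 2) ≠ 0) :
    BigOFrom 2 (fun n : ℕ => ENNReal.ofReal (psiLog 1 γ K n * n * Real.log n))
      (bestApprox (classC (psiLog 1 γ K) β 1)) := by
  have hpi := Real.pi_pos
  have hcos : 0 < |Real.cos (β * Real.pi / 2)| := abs_pos.2 hβ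
  refine bigOFrom_of_ge (c := |Real.cos (β * Real.pi / 2)| * (1 / (4 * Real.pi) * 4 ^ (-γ)) / 4)
    (by positivity) fun n hn => ?_
  have hn' : (0 : ℝ) < n := by exact_mod_cast (by omega : 0 < n)
  have h := ofReal_abs_sum_le_bestApprox (p := 1) (γ := γ) (β := β) (n := n) hK (by omega)
    (normLper_one_fejer_le (8 * n ^ 2)) 0
  refine le_trans (ENNReal.ofReal_le_ofReal ?_) h
  have e := psiLog_mul_rpow (p := 1) (γ := γ) (K := K) hn'
  rw [div_one, Real.rpow_one] at e
  rw [e]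
  -- Twice the upper end of the range [2n, 4n²), so that the Fejér multipliers there are at least
  -- 1/2.
  set N := 8 * n ^ 2 with hN
  have hN0 : (0 : ℝ) < N := by
    rw [hN]
    positivity
  have hψ : ∀ k : ℕ, psiLog 1 γ K k = (k : ℝ)⁻¹ * Real.log (k + K) ^ (-γ) := fun k => by
    rw [psiLog, div_one, Real.rpow_neg_one]
  have h1 := log_le_sum_vpCoef (K := K) (γ := γ) (r := 1 / (4 * Real.pi)) hK (by linarith)
    (by positivity) (by omega : 1 ≤ n) (N := N) (by omega)
    (w := fun k => psiLog 1 γ K k * (1 / (2 * Real.pi) * (1 - (k : ℝ) / N)))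
    (fun k hk hkN => ?_) (fun k hk hkN => ?_)
  · have h2 : ∑ k ∈ Finset.Ico 1 N, (1 - vpCoef n k) * (psiLog 1 γ K k
        * (1 / (2 * Real.pi) * (1 - (k : ℝ) / N)) * Real.cos (k * 0 - (0 + β * Real.pi / 2)))
        = (∑ k ∈ Finset.Ico 1 N, (1 - vpCoef n k) * (psiLog 1 γ K k
        * (1 / (2 * Real.pi) * (1 - (k : ℝ) / N)))) * Real.cos (β * Real.pi / 2) := by
      rw [Finset.sum_mul]
      refine Finset.sum_congr rfl fun k _ => ?_
      rw [mul_zero, zero_add, zero_sub, Real.cos_neg]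
      ring
    rw [h2, abs_mul]
    have h3 := h1.trans (le_abs_self _)
    have h4 := mul_le_mul_of_nonneg_right h3 hcos.le
    linarith
  · have hkN' : (k : ℝ) / N ≤ 1 := (div_le_one hN0).2 (by exact_mod_cast hkN.le)
    have := powLog_nonneg (a := 1 / 1) (γ := γ) hK (Nat.cast_nonneg k)
    rw [← psiLog_eq_powLog] at this
    exact mul_nonneg this (mul_nonneg (by positivity) (by linarith))
  · have hkN' : (k : ℝ) / N ≤ 1 / 2 := by
      rw [div_le_iff₀ hN0]
      have : (k : ℝ) ≤ 4 * (n : ℝ) ^ 2 := by exact_mod_cast hkN.le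
      rw [hN]
      push_cast
      linarith
    have := powLog_nonneg (a := 1 / 1) (γ := γ) hK (Nat.cast_nonneg k)
    rw [← psiLog_eq_powLog] at this
    rw [← hψ]
    calc _ = psiLog 1 γ K k * (1 / (2 * Real.pi) * (1 / 2)) := by ring
      _ ≤ _ := by gcongr; linarith

theorem one_bigO_bestApprox_of_cos_eq_zero {γ K β : ℝ} (hK : 1 < K) (hγ : 1 < γ)
    (hβ : Real.cos (β * Real.pi / 2) = 0) :
    BigOFrom 1 (fun n : ℕ => ENNReal.ofReal (psiLog 1 γ K n * n))
      (bestApprox (classC (psiLog 1 γ K) β 1)) := by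
  have hpi := Real.pi_pos
  have hsin : |Real.sin (β * Real.pi / 2)| = 1 := by
    have := Real.sin_sq_add_cos_sq (β * Real.pi / 2)
    rw [hβ] at this
    rw [← sq_eq_sq₀ (abs_nonneg _) zero_le_one, sq_abs]
    linarith
  refine bigOFrom_of_ge (c := 1 / (48 * Real.pi) * 4 ^ (-γ) / 4) (by positivity) fun n hn => ?_
  have hn1 : (1 : ℝ) ≤ n := by exact_mod_cast hn
  have hn' : (0 : ℝ) < n := by linarith
  have hl := log_add_pos hK hn'.le
  have h := ofReal_abs_sum_le_bestApprox (p := 1) (γ := γ) (β := β) (n := n) hK hn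
    (normLper_one_fejer_le (4 * n)) (Real.pi / (4 * n))
  refine le_trans (ENNReal.ofReal_le_ofReal ?_) h
  have e := psiLog_mul_rpow (p := 1) (γ := γ) (K := K) hn'
  rw [div_one, Real.rpow_one] at e
  rw [e]
  -- At 0 the sum would vanish. Here k x₀ lies in [0, π] for every k < 4n, so no term is negative,
  -- and in [π/2, 3π/4] for 2n ≤ k ≤ 3n.
  set x₀ := Real.pi / (4 * n) with hx₀
  have hx0 : 0 < x₀ := by positivity
  set w : ℕ → ℝ := fun k => (1 - vpCoef n k) * (psiLog 1 γ K k
      * (1 / (2 * Real.pi) * (1 - (k : ℝ) / (4 * n : ℕ))) * Real.sin (k * x₀)) with hw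
  have h2 : ∑ k ∈ Finset.Ico 1 (4 * n), (1 - vpCoef n k) * (psiLog 1 γ K k
      * (1 / (2 * Real.pi) * (1 - (k : ℝ) / (4 * n : ℕ)))
      * Real.cos (k * x₀ - (0 + β * Real.pi / 2)))
      = (∑ k ∈ Finset.Ico 1 (4 * n), w k) * Real.sin (β * Real.pi / 2) := by
    rw [Finset.sum_mul]
    refine Finset.sum_congr rfl fun k _ => ?_
    rw [zero_add, Real.cos_sub, hβ, hw]
    ring
  have hψ0 : ∀ k : ℕ, 0 ≤ psiLog 1 γ K k := fun k => by
    have := powLog_nonneg (a := 1 / 1) (γ := γ) hK (Nat.cast_nonneg k)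
    rwa [← psiLog_eq_powLog] at this
  have hw0 : ∀ k ∈ Finset.Ico 1 (4 * n), 0 ≤ w k := by
    intro k hk
    have hk2 : (k : ℝ) ≤ (4 * n : ℕ) := by exact_mod_cast (Finset.mem_Ico.1 hk).2.le
    have h3 : (k : ℝ) / (4 * n : ℕ) ≤ 1 := div_le_one_of_le₀ hk2 (by positivity)
    have h4 : k * x₀ ≤ Real.pi := by
      calc _ ≤ ((4 * n : ℕ) : ℝ) * x₀ := by gcongr
        _ = Real.pi := by rw [hx₀]; push_cast; field_simp
    refine mul_nonneg (sub_nonneg.2 (vpCoef_le_one n k)) (mul_nonneg (mul_nonneg (hψ0 k)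
      (mul_nonneg (by positivity) (by linarith)))
      (Real.sin_nonneg_of_nonneg_of_le_pi (by positivity) h4))
  -- The constant is 1/3 from 1/k, 1/(2π) from normalization, 1/4 from the Fejér multiplier and 1/2
  -- from the sine.
  have hw1 : ∀ k ∈ Finset.Ico (2 * n) (3 * n),
      1 / (48 * Real.pi) * (1 / n) * (4 ^ (-γ) * Real.log (n + K) ^ (-γ)) ≤ w k := by
    intro k hk
    have hk := Finset.mem_Ico.1 hk
    have hk1 : 2 * (n : ℝ) ≤ k := by exact_mod_cast hk.1
    have hk2 : (k : ℝ) ≤ 3 * n := by exact_mod_cast hk.2.le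
    have hk0 : (0 : ℝ) < k := by linarith
    have hs : 1 / 2 ≤ Real.sin (k * x₀) := by
      rw [← Real.sin_pi_sub]
      have a1 : Real.pi / 4 ≤ Real.pi - k * x₀ := by
        have : k * x₀ ≤ 3 * n * x₀ := by gcongr
        have e2 : 3 * n * x₀ = 3 * Real.pi / 4 := by rw [hx₀]; field_simp
        linarith
      have a2 : Real.pi - k * x₀ ≤ Real.pi / 2 := by
        have : 2 * n * x₀ ≤ k * x₀ := by gcongr
        have e2 : 2 * n * x₀ = Real.pi / 2 := by rw [hx₀]; field_simp; norm_num
        linarith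
      refine le_trans ?_ (Real.mul_le_sin (by linarith) a2)
      calc (1 : ℝ) / 2 = 2 / Real.pi * (Real.pi / 4) := by field_simp; norm_num
        _ ≤ _ := by gcongr
    have hf : 1 / 4 ≤ 1 - (k : ℝ) / (4 * n : ℕ) := by
      have : (k : ℝ) / (4 * n : ℕ) ≤ 3 / 4 := by
        push_cast
        rw [div_le_iff₀ (by positivity)]
        linarith
      linarith
    have hψ : 1 / (3 * n) * (4 ^ (-γ) * Real.log (n + K) ^ (-γ)) ≤ psiLog 1 γ K k := by
      rw [psiLog, div_one, Real.rpow_neg_one, ← one_div]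
      have := log_rpow_neg_ge (γ := γ) hK (by linarith) hn hk0.le (by nlinarith)
      gcongr
    rw [hw]
    beta_reduce
    rw [vpCoef_eq_zero hn hk.1, sub_zero, one_mul]
    calc _ = 1 / (3 * n) * (4 ^ (-γ) * Real.log (n + K) ^ (-γ))
          * (1 / (2 * Real.pi) * (1 / 4)) * (1 / 2) := by field_simp; norm_num
      _ ≤ _ := by
        have := hψ0 k
        gcongr
  have h5 : 1 / (48 * Real.pi) * (4 ^ (-γ) * Real.log (n + K) ^ (-γ))
      ≤ ∑ k ∈ Finset.Ico 1 (4 * n), w k := by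
    refine le_trans ?_ (Finset.sum_le_sum_of_subset_of_nonneg
      (Finset.Ico_subset_Ico (by omega) (by omega) : Finset.Ico (2 * n) (3 * n) ⊆ _)
      fun k hk _ => hw0 k hk)
    refine le_trans (le_of_eq ?_) (Finset.card_nsmul_le_sum _ _ _ hw1)
    rw [Nat.card_Ico, show 3 * n - 2 * n = n by omega, nsmul_eq_mul]
    field_simp
  rw [h2, abs_mul, hsin, mul_one]
  have := h5.trans (le_abs_self _)
  linarith

/-! #### The case `1 < p` -/

/-- The first bound comes from a cut at π/u and Abel summation; the second is trivial and serves for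
u < 1/N. The factor 1 matches the shape required by `integral_abs_rpow_le`. -/
theorem abs_sum_rpow_cos_le {a : ℝ} (ha : 0 ≤ a) (ha1 : a < 1) :
    ∃ C : ℝ, 0 < C ∧ ∀ (N : ℕ) (c u : ℝ), 0 < u → u ≤ Real.pi →
      |cosSum (fun k => (k : ℝ) ^ (-a)) c N u| ≤ C * (u ^ (a - 1) * 1) ∧
      |cosSum (fun k => (k : ℝ) ^ (-a)) c N u| ≤ C * (N : ℝ) ^ (1 - a) := by
  have hpi := Real.pi_pos
  have h1a : 0 < 1 - a := by linarith
  have hC : 0 < (2 * Real.pi) ^ (1 - a) / (1 - a) := by positivity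
  have h1C : 1 / (1 - a) ≤ (2 * Real.pi) ^ (1 - a) / (1 - a) + Real.pi := by
    have : 1 ≤ (2 * Real.pi) ^ (1 - a) :=
      Real.one_le_rpow (by linarith [Real.pi_gt_three]) h1a.le
    have : 1 / (1 - a) ≤ (2 * Real.pi) ^ (1 - a) / (1 - a) := by gcongr
    linarith
  have htriv : ∀ (A B : ℕ) (c u : ℝ),
      |∑ k ∈ Finset.Ico A B, (k : ℝ) ^ (-a) * Real.cos (k * u - c)|
        ≤ ∑ k ∈ Finset.Ico A B, (k : ℝ) ^ (-a) := by
    intro A B c u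
    refine (Finset.abs_sum_le_sum_abs _ _).trans (Finset.sum_le_sum fun k _ => ?_)
    rw [abs_mul, abs_of_nonneg (by positivity)]
    exact mul_le_of_le_one_right (by positivity) (Real.abs_cos_le_one _)
  refine ⟨(2 * Real.pi) ^ (1 - a) / (1 - a) + Real.pi, by positivity, fun N c u hu hupi => ⟨?_, ?_⟩⟩
  · have h1u : 0 < 1 / u := by positivity
    set M := ⌈Real.pi / u⌉₊ with hM
    have hM1 : Real.pi / u ≤ M := Nat.le_ceil _
    have hMu : 1 / u ≤ M := le_trans (by gcongr; linarith [Real.pi_gt_three]) hM1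
    have h1pu : 1 ≤ Real.pi / u := (one_le_div hu).2 hupi
    have hM2 : (M : ℝ) ≤ 2 * Real.pi / u := by
      have := (Nat.ceil_lt_add_one (by positivity : 0 ≤ Real.pi / u)).le
      rw [mul_div_assoc]
      linarith
    have hM0 : 1 ≤ M := by exact_mod_cast h1pu.trans hM1
    have hMpos : (0 : ℝ) < M := by exact_mod_cast hM0
    have hhead : ∀ B : ℕ, B ≤ M → |∑ k ∈ Finset.Ico 1 B, (k : ℝ) ^ (-a) * Real.cos (k * u - c)|
        ≤ (2 * Real.pi) ^ (1 - a) / (1 - a) * (u ^ (a - 1) * 1) := by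
      intro B hB
      calc _ ≤ _ := htriv 1 B c u
        _ ≤ (B : ℝ) ^ (1 - a) / (1 - a) := sum_rpow_neg_le' ha ha1 B
        _ ≤ (2 * Real.pi / u) ^ (1 - a) / (1 - a) := by
            have : (B : ℝ) ≤ M := by exact_mod_cast hB
            have := this.trans hM2
            gcongr
        _ = _ := by
            rw [Real.div_rpow (by positivity) hu.le, ← neg_sub 1 a, Real.rpow_neg hu.le]
            ring
    rw [cosSum, add_mul]
    rcases le_total N M with hNM | hNM
    · refine (hhead N hNM).trans (le_add_of_nonneg_right (by positivity))
    · rw [← Finset.sum_Ico_consecutive _ hM0 hNM]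
      refine (abs_add_le _ _).trans (add_le_add (hhead M le_rfl) ?_)
      have htail := abs_sum_Ico_mul_le_of_antitone (c := fun k : ℕ => (k : ℝ) ^ (-a)) hNM
        (fun k hk _ => ?_) (by positivity) fun j _ _ => abs_sum_cos_le M j c hu hupi
      · refine htail.trans ?_
        rw [mul_one, ← inv_rpow_neg_mul_div hu]
        have := Real.rpow_le_rpow_of_nonpos h1u hMu (by linarith : -a ≤ 0)
        gcongr
      · have hk0 : (0 : ℝ) < k := by exact_mod_cast hM0.trans hk
        exact Real.rpow_le_rpow_of_nonpos hk0 (by simp) (by linarith)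
  · calc _ ≤ _ := htriv 1 N c u
      _ ≤ (N : ℝ) ^ (1 - a) / (1 - a) := sum_rpow_neg_le' ha ha1 N
      _ = 1 / (1 - a) * (N : ℝ) ^ (1 - a) := by ring
      _ ≤ _ := by gcongr

/-- On (0, 1/N) the trivial bound contributes O(1); on (1/N, π) the p-th power is O(1/u), which
gives ln(πN) with N = 4n², hence O(ln n). -/
theorem integral_abs_cosSum_rpow_le {p q : ℝ} (hpq : p.HolderConjugate q) :
    ∃ C : ℝ, 0 < C ∧ ∀ (n : ℕ) (c : ℝ), 2 ≤ n →
      ∫ t in (0 : ℝ)..(2 * Real.pi),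
        |cosSum (fun k => (k : ℝ) ^ (-(1 / q))) c (4 * n ^ 2) t| ^ p ≤ C * Real.log n := by
  have hp0 := hpq.pos
  have hq0 := hpq.symm.pos
  have hpi := Real.pi_pos
  have hsum := hpq.inv_add_inv_eq_one
  rw [← one_div, ← one_div] at hsum
  have hpinv : 0 < 1 / p := by positivity
  obtain ⟨C, hC, h⟩ := abs_sum_rpow_cos_le (a := 1 / q) (by positivity) (by linarith)
  have e1 : 1 / q - 1 = -(1 / p) := by linarith
  have e2 : 1 - 1 / q = 1 / p := by linarith
  have hlog2 : 0 < Real.log 2 := Real.log_pos (by norm_num)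
  have hlogpi : 0 < Real.log (Real.pi * 4) := Real.log_pos (by linarith [Real.pi_gt_three])
  refine ⟨2 * (C ^ p * ((1 + Real.log (Real.pi * 4)) / Real.log 2 + 2)), by positivity,
    fun n c hn => ?_⟩
  have hn' : (2 : ℝ) ≤ n := by exact_mod_cast hn
  have hln : Real.log 2 ≤ Real.log n := Real.log_le_log (by norm_num) hn'
  set N := 4 * n ^ 2 with hN
  have hNe : (N : ℝ) = 4 * (n : ℝ) ^ 2 := by rw [hN]; push_cast; ring
  have hN1 : (1 : ℝ) ≤ N := by rw [hNe]; nlinarith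
  have hN0 : (0 : ℝ) < N := by linarith
  have half : ∀ c : ℝ, ∫ u in (0 : ℝ)..Real.pi,
      |cosSum (fun k => (k : ℝ) ^ (-(1 / q))) c N u| ^ p
        ≤ C ^ p * ((1 + Real.log (Real.pi * 4)) / Real.log 2 + 2) * Real.log n := by
    intro c
    have hc := continuous_cosSum (fun k => (k : ℝ) ^ (-(1 / q))) c N
    have hcp : Continuous fun u => |cosSum (fun k => (k : ℝ) ^ (-(1 / q))) c N u| ^ p :=
      hc.abs.rpow_const fun _ => Or.inr hp0.le
    have hb : (0 : ℝ) < 1 / N := by positivity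
    have hb1 : 1 / (N : ℝ) ≤ 1 := (div_le_one hN0).2 hN1
    have hs : ∫ u in (0 : ℝ)..(1 / N), |cosSum (fun k => (k : ℝ) ^ (-(1 / q))) c N u| ^ p
        ≤ C ^ p := by
      calc _ ≤ ∫ u in (0 : ℝ)..(1 / N), C ^ p * N := by
            refine intervalIntegral.integral_mono_on_of_le_Ioo hb.le (hcp.intervalIntegrable _ _)
              (by simp) fun u hu => ?_
            have hupi : u ≤ Real.pi := by linarith [hu.2, Real.pi_gt_three]
            refine (Real.rpow_le_rpow (abs_nonneg _) (h N c u hu.1 hupi).2 hp0.le).trans_eq ?_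
            rw [Real.mul_rpow hC.le (by positivity), ← Real.rpow_mul hN0.le, e2,
              one_div_mul_cancel hp0.ne', Real.rpow_one]
        _ = C ^ p := by
            rw [intervalIntegral.integral_const, sub_zero, smul_eq_mul]
            field_simp
    have hlg := integral_abs_rpow_le hc hC hpq.lt hb hb1 zero_le_one fun u hu1 hu2 => by
      rw [← e1]
      exact (h N c u (hb.trans_le hu1) hu2).1
    rw [Real.one_rpow, mul_one, div_div_eq_mul_div, div_one, hNe, ← mul_assoc,
      Real.log_mul (by positivity) (by positivity), Real.log_pow] at hlg
    rw [← intervalIntegral.integral_add_adjacent_intervals (hcp.intervalIntegrable 0 (1 / N))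
      (hcp.intervalIntegrable (1 / N) Real.pi)]
    rw [← hNe] at hlg
    refine (add_le_add hs hlg).trans ?_
    have h5 : 1 + Real.log (Real.pi * 4)
        ≤ (1 + Real.log (Real.pi * 4)) / Real.log 2 * Real.log n := by
      calc _ = (1 + Real.log (Real.pi * 4)) / Real.log 2 * Real.log 2 := by field_simp
        _ ≤ _ := by gcongr
    calc _ = C ^ p * (1 + Real.log (Real.pi * 4) + 2 * Real.log n) := by push_cast; ring
      _ ≤ C ^ p * ((1 + Real.log (Real.pi * 4)) / Real.log 2 * Real.log n + 2 * Real.log n) := by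
          gcongr
      _ = _ := by ring
  have h6 := integral_abs_rpow_comp_sub
    (continuous_cosSum (fun k => (k : ℝ) ^ (-(1 / q))) (-c) N) (cosSum_periodic _ _ _) hp0.le 0
  simp only [zero_sub, cosSum_neg, neg_neg] at h6
  rw [h6]
  have := half c
  have := half (-c)
  linarith

theorem normLper_const_mul_cosSum_le {p : ℝ} (hp : 0 < p) {l : ℕ → ℝ} {c : ℝ} {N : ℕ} {I : ℝ}
    (hI : 0 < I) (h : ∫ t in (0 : ℝ)..(2 * Real.pi), |cosSum l c N t| ^ p ≤ I) :
    normLper (ENNReal.ofReal p) (cosSum (fun k => I ^ (-(1 / p)) * l k) c N) ≤ 1 := by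
  have h0 : ∀ t, cosSum (fun k => I ^ (-(1 / p)) * l k) c N t = I ^ (-(1 / p)) * cosSum l c N t := by
    intro t
    rw [cosSum, cosSum, Finset.mul_sum]
    exact Finset.sum_congr rfl fun k _ => by ring
  rw [normLper, (memLper_cosSum _ c N (ENNReal.ofReal p)).2.eLpNorm_eq_integral_rpow_norm
    (by simpa using hp) ENNReal.ofReal_ne_top, ENNReal.toReal_ofReal hp.le, ENNReal.ofReal_le_one,
    ← intervalIntegral.integral_of_le Real.two_pi_pos.le]
  have h1 : ∀ t, ‖cosSum (fun k => I ^ (-(1 / p)) * l k) c N t‖ ^ p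
      = I⁻¹ * |cosSum l c N t| ^ p := by
    intro t
    rw [h0, norm_mul, Real.norm_of_nonneg (by positivity), Real.mul_rpow (by positivity)
      (norm_nonneg _), ← Real.rpow_mul hI.le, neg_mul, one_div_mul_cancel hp.ne',
      Real.rpow_neg_one, Real.norm_eq_abs]
  simp_rw [h1]
  rw [intervalIntegral.integral_const_mul]
  refine Real.rpow_le_one ?_ ?_ (by positivity)
  · exact mul_nonneg (by positivity) (intervalIntegral.integral_nonneg Real.two_pi_pos.le
      fun u _ => by positivity)
  · rwa [inv_mul_le_iff₀ hI, mul_one]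

theorem bigO_bestApprox {p q γ K : ℝ} (β : ℝ) (hpq : p.HolderConjugate q) (hK : 1 < K)
    (hγ : 0 < γ) :
    BigOFrom 2 (fun n : ℕ => ENNReal.ofReal
        (psiLog p γ K n * (n : ℝ) ^ (1 / p) * Real.log n ^ (1 / q)))
      (bestApprox (classC (psiLog p γ K) β (ENNReal.ofReal p))) := by
  have hp0 := hpq.pos
  have hq0 := hpq.symm.pos
  have hsum := hpq.inv_add_inv_eq_one
  rw [← one_div, ← one_div] at hsum
  obtain ⟨C, hC, h⟩ := integral_abs_cosSum_rpow_le hpq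
  refine bigOFrom_of_ge (c := C ^ (-(1 / p)) * 4 ^ (-γ) / 4) (by positivity) fun n hn => ?_
  have hn' : (2 : ℝ) ≤ n := by exact_mod_cast hn
  have hln : 0 < Real.log n := Real.log_pos (by linarith)
  rw [psiLog_mul_rpow (by linarith)]
  -- The phase -βπ/2 makes every cosine equal to 1 at 0, for any β. The amplitudes k^(-1/q) turn
  -- ψ(k) into k^(-1) ln^(-γ)(k + K), and normalization leaves (ln n)^(1 - 1/p) = (ln n)^(1/q).
  have h1 := ofReal_abs_sum_le_bestApprox (p := p) (γ := γ) (β := β) (n := n) hK (by omega)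
    (normLper_const_mul_cosSum_le hp0 (mul_pos hC hln) (h n (-(β * Real.pi / 2)) hn)) 0
  refine le_trans (ENNReal.ofReal_le_ofReal ?_) h1
  simp only [mul_zero, neg_add_cancel, sub_zero, Real.cos_zero, mul_one]
  have e3 : ∀ k : ℕ, 1 ≤ k → psiLog p γ K k * ((C * Real.log n) ^ (-(1 / p)) * (k : ℝ) ^ (-(1 / q)))
      = (C * Real.log n) ^ (-(1 / p)) * ((k : ℝ)⁻¹ * Real.log (k + K) ^ (-γ)) := by
    intro k hk
    have hk0 : (0 : ℝ) < k := by exact_mod_cast hk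
    have : (k : ℝ)⁻¹ = (k : ℝ) ^ (-(1 / p)) * (k : ℝ) ^ (-(1 / q)) := by
      rw [← Real.rpow_add hk0, ← neg_add, hsum, Real.rpow_neg_one]
    rw [this, psiLog]
    ring
  have h2 := log_le_sum_vpCoef (K := K) (γ := γ) (r := (C * Real.log n) ^ (-(1 / p))) hK hγ.le
    (by positivity) (by omega : 1 ≤ n) le_rfl
    (w := fun k => psiLog p γ K k * ((C * Real.log n) ^ (-(1 / p)) * (k : ℝ) ^ (-(1 / q))))
    (fun k hk _ => ?_) (fun k hk _ => (e3 k (by omega)).ge)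
  · have h3 := h2.trans (le_abs_self _)
    have e4 : (C * Real.log n) ^ (-(1 / p)) * Real.log n
        = C ^ (-(1 / p)) * Real.log n ^ (1 / q) := by
      rw [Real.mul_rpow hC.le hln.le, mul_assoc, ← Real.rpow_add_one hln.ne']
      congr 2
      linarith
    have e5 : (C * Real.log n) ^ (-(1 / p)) * ((4 : ℝ) ^ (-γ) * Real.log (n + K) ^ (-γ)
        * Real.log n) = C ^ (-(1 / p)) * 4 ^ (-γ) * (Real.log (n + K) ^ (-γ)
        * Real.log n ^ (1 / q)) := by
      linear_combination (4 : ℝ) ^ (-γ) * Real.log (n + K) ^ (-γ) * e4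
    rw [e5] at h3
    linarith
  · have := powLog_nonneg (a := 1 / p) (γ := γ) hK (Nat.cast_nonneg k)
    rw [← psiLog_eq_powLog] at this
    exact mul_nonneg this (by positivity)

/-! ### Order equalities -/

theorem BigOFrom.trans {N : ℕ} {A B D : ℕ → ℝ≥0∞} (h₁ : BigOFrom N A B) (h₂ : BigOFrom N B D) :
    BigOFrom N A D := by
  obtain ⟨c₁, hc₁, h₁⟩ := h₁
  obtain ⟨c₂, hc₂, h₂⟩ := h₂
  refine ⟨c₁ * c₂, mul_pos hc₁ hc₂, fun n hn => (h₁ n hn).trans ?_⟩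
  rw [ENNReal.ofReal_mul hc₁.le, mul_assoc]
  gcongr
  exact h₂ n hn

/-- The three quantities close into a cycle of estimates. -/
theorem orderEqFrom_of_bigO {N : ℕ} {s : ℝ} {F : Set (ℝ → ℝ)} {R : ℕ → ℝ≥0∞}
    (hU : BigOFrom N (zygmundDev s F) R) (hL : BigOFrom N R (bestApprox F)) :
    OrderEqFrom N (bestApprox F) (zygmundDev s F) ∧ OrderEqFrom N (zygmundDev s F) R := by
  have h : BigOFrom N (bestApprox F) (zygmundDev s F) :=
    ⟨1, one_pos, fun n _ => by simpa using bestApprox_le_zygmundDev s F n⟩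
  exact ⟨⟨h, hU.trans hL⟩, ⟨hU, hL.trans h⟩⟩

end ZygmundApprox

end

theorem theorem3 (s β : ℝ) (hs : 0 < s) :
    (∀ p p' γ K : ℝ, 1 < p → 1 / p + 1 / p' = 1 → 1 / p' < γ → Real.exp (γ * p' / 2) < K →
      ZygmundApprox.OrderEqFrom 2
        (ZygmundApprox.bestApprox
          (ZygmundApprox.classC (ZygmundApprox.psiLog p γ K) β (ENNReal.ofReal p)))
        (ZygmundApprox.zygmundDev s
          (ZygmundApprox.classC (ZygmundApprox.psiLog p γ K) β (ENNReal.ofReal p))) ∧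
      ZygmundApprox.OrderEqFrom 2
        (ZygmundApprox.zygmundDev s
          (ZygmundApprox.classC (ZygmundApprox.psiLog p γ K) β (ENNReal.ofReal p)))
        (fun n : ℕ => ENNReal.ofReal
          (ZygmundApprox.psiLog p γ K (n : ℝ) * (n : ℝ) ^ (1 / p)
            * Real.log (n : ℝ) ^ (1 / p')))) ∧
    (∀ γ K : ℝ, 1 < γ → Real.exp γ < K →
      (Real.cos (β * Real.pi / 2) ≠ 0 →
        ZygmundApprox.OrderEqFrom 2
          (ZygmundApprox.bestApprox
            (ZygmundApprox.classC (ZygmundApprox.psiLog 1 γ K) β 1))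
          (ZygmundApprox.zygmundDev s
            (ZygmundApprox.classC (ZygmundApprox.psiLog 1 γ K) β 1)) ∧
        ZygmundApprox.OrderEqFrom 2
          (ZygmundApprox.zygmundDev s
            (ZygmundApprox.classC (ZygmundApprox.psiLog 1 γ K) β 1))
          (fun n : ℕ => ENNReal.ofReal
            (ZygmundApprox.psiLog 1 γ K (n : ℝ) * (n : ℝ) * Real.log (n : ℝ)))) ∧
      (Real.cos (β * Real.pi / 2) = 0 →
        ZygmundApprox.OrderEqFrom 1
          (ZygmundApprox.bestApprox
            (ZygmundApprox.classC (ZygmundApprox.psiLog 1 γ K) β 1))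
          (ZygmundApprox.zygmundDev s
            (ZygmundApprox.classC (ZygmundApprox.psiLog 1 γ K) β 1)) ∧
        ZygmundApprox.OrderEqFrom 1
          (ZygmundApprox.zygmundDev s
            (ZygmundApprox.classC (ZygmundApprox.psiLog 1 γ K) β 1))
          (fun n : ℕ => ENNReal.ofReal
            (ZygmundApprox.psiLog 1 γ K (n : ℝ) * (n : ℝ))))) := by
  refine ⟨fun p p' γ K hp hpp hγ hK => ?_, fun γ K hγ hK => ⟨fun hβ => ?_, fun hβ => ?_⟩⟩
  · have hpq : p.HolderConjugate p' :=
      Real.holderConjugate_iff.2 ⟨hp, by rwa [← one_div, ← one_div]⟩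
    have hp' := hpq.symm.pos
    have hγ0 : 0 < γ := lt_trans (by positivity) hγ
    have hK1 : 1 < K := (Real.one_le_exp (by positivity)).trans_lt hK
    -- In the form γp' > 1 this is the integrability of the p'-th power of the kernel bound at 0.
    rw [div_lt_iff₀ hp'] at hγ
    exact ZygmundApprox.orderEqFrom_of_bigO (ZygmundApprox.zygmundDev_bigO β hpq hK1 hγ hs)
      (ZygmundApprox.bigO_bestApprox β hpq hK1 hγ0)
  · have hK1 : 1 < K := (Real.one_le_exp (by linarith)).trans_lt hK
    exact ZygmundApprox.orderEqFrom_of_bigO (ZygmundApprox.zygmundDev_one_bigO β hK1 hγ hs)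
      (ZygmundApprox.one_bigO_bestApprox hK1 hγ hβ)
  · have hK1 : 1 < K := (Real.one_le_exp (by linarith)).trans_lt hK
    exact ZygmundApprox.orderEqFrom_of_bigO
      (ZygmundApprox.zygmundDev_one_bigO_of_cos_eq_zero hK1 hγ hs hβ)
      (ZygmundApprox.one_bigO_bestApprox_of_cos_eq_zero hK1 hγ hβ)
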